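/- Let $d\in\mathbb N$ and let $\mu,\nu\in\mathcal P_2(\mathbb R^d)$ be in convex order. For probability measures $\eta,\rho$ let $\mathsf{Cpl}(\eta,\rho)$ be the set of couplings, $\mathsf{MT}(\mu,\nu)\subset\mathsf{Cpl}(\mu,\nu)$ the set of martingale couplings (laws of $(X,Y)$ with $\mathbb E[Y\mid X]=X$), $H(\cdot|\cdot)$ the relative entropy, and $\mathrm{MCov}(\eta,\mu)=\sup_{\kappa\in\mathsf{Cpl}(\eta,\mu)}\int \bar x\cdot x\,d\kappa$. Consider the problems - (P): $\inf_{m\in\mathsf{MT}(\mu,\nu)}H(m|\mu\otimes\nu)$; - (SP$(\eta,\nu)$): $\inf_{\pi\in\mathsf{Cpl}(\eta,\nu)}\big[H(\pi|\eta\otimes\nu)-\int\bar x\cdot y\,d\pi\big]$; - (VP): $\sup_{\eta\in\mathcal P_2(\mathbb R^d)}\big\{\text{value of }SP(\eta,\nu)+\mathrm{MCov}(\eta,\mu)\big\}$; - (I$_x$): $\sup_{k\in\mathbb R^d}\big\{k\cdot x-\log\int e^{k\cdot y+\psi(y)}\nu(dy)\big\}$; - (D): $\sup_{\psi\in C_b(\mathbb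 R^d)}\mathcal D(\psi)$, where $\mathcal D(\psi)=\int\psi\,d\nu+\int\sup_{k}\big[k\cdot x-\log\int e^{k\cdot y+\psi(y)}\nu(dy)\big]\mu(dx)$. Assume: - (H1) $\int e^{q|y|}\nu(dy)<\infty$ for all $q\ge 0$; - (H2) $\nu$ is not concentrated on any affine hyperplane; - (H3) the value of (D) is finite and equals $\mathcal D(\psi)$ for a $\nu$-integrable $\psi$ with $|\psi(y)|\le a+b|y|$ for $\nu$-a.e. $y$, for some $a,b\ge0$; - (H4) for $\mu$-a.e. $x$ the problem (I$_x$) for this $\psi$ has a unique solution, denoted $h(x)$. Define $\bar\mu=h_\#\mu$; $\bar\varphi(\bar x)=-\log\int e^{\psi(y)+\bar x\cdot y}\nu(dy)$; the Gibbs kernel $m_x(dy)=\dfrac{e^{h(x)\cdot y+\psi(y)}}{\int e^{h(x)\cdot z+\psi(z)}\nu(dz)}\,\nu(dy)$ and $m(dx,dy)=\mu(dx)m_x(dy)$; and $\pi$ by $\dfrac{d\pi}{d\bar\mu\otimes\nu}(\bar x,y)=e^{\bar\varphi(\bar x)+\psi(y)+\bar x\cdot y}$. Then $h$ is $\mu$-a.e.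 equal to a measurable map, and: 1. $\pi\in\mathsf{Cpl}(\bar\mu,\nu)$, and $(\bar\varphi,\psi)$ are Schrödinger potentials for $(\bar\mu,\nu)$, that is, $\int e^{\bar\varphi(\bar x)+\psi(y)+\bar x\cdot y}\nu(dy)=1$ for $\bar\mu$-a.e. $\bar x$ and $\int e^{\bar\varphi(\bar x)+\psi(y)+\bar x\cdot y}\bar\mu(d\bar x)=1$ for $\nu$-a.e. $y$. If moreover $\bar\mu\in\mathcal P_2(\mathbb R^d)$, i.e. $\int|h|^2d\mu<\infty$, so that $\bar\mu$ is admissible for (VP), then $\bar\mu$ solves (VP) and $\pi$ solves $SP(\bar\mu,\nu)$. 2. $m\in\mathsf{MT}(\mu,\nu)$, and $m$ solves (P). -/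

import Mathlib

open MeasureTheory

namespace MSB

/-- Euclidean space of dimension `d`. -/
abbrev E (d : ℕ) : Type := EuclideanSpace ℝ (Fin d)

/-- The integral of an extended-real function, positive part minus negative part. It is the usual
integral with values in `[-∞, +∞]` when one of the two parts has a finite integral, which is the
case wherever it is used below. -/
noncomputable def extIntegral {α : Type*} [MeasurableSpace α] (f : α → EReal) (μ : Measure α) :
    EReal :=
  ((∫⁻ x, (f x).toENNReal ∂μ : ENNReal) : EReal) - ((∫⁻ x, (-f x).toENNReal ∂μ : ENNReal) : EReal)

variable {d : ℕ}

/-- Probability measures with finite second moment. -/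
def P2 (d : ℕ) : Set (Measure (E d)) :=
  {η | IsProbabilityMeasure η ∧ MemLp (fun x => x) 2 η}

/-- Convex order: `∫ φ dμ ≤ ∫ φ dν` (in `(-∞, +∞]`) for all convex `φ`. -/
def ConvexOrder (μ ν : Measure (E d)) : Prop :=
  ∀ φ : E d → ℝ, ConvexOn ℝ Set.univ φ →
    extIntegral (fun x => (φ x : EReal)) μ ≤ extIntegral (fun x => (φ x : EReal)) ν

/-- Couplings of `η` (first marginal) and `ν` (second marginal). -/
def Cpl (η ν : Measure (E d)) : Set (Measure (E d × E d)) :=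
  {π | π.fst = η ∧ π.snd = ν}

/-- Martingale couplings: couplings `m` with `𝔼[Y | X] = X` for `(X, Y) ∼ m`. -/
def MT (μ ν : Measure (E d)) : Set (Measure (E d × E d)) :=
  {m | m ∈ Cpl μ ν ∧ Integrable (fun p : E d × E d => p.2) m ∧
    condExp (MeasurableSpace.comap (Prod.fst : E d × E d → E d) inferInstance) m
      (fun p : E d × E d => p.2) =ᵐ[m] (fun p => p.1)}

/-- `m` solves the problem (P): minimise `H(m | μ ⊗ ν)` over the martingale couplings. -/
def SolvesP (μ ν : Measure (E d)) (m : Measure (E d × E d)) : Prop :=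
  m ∈ MT μ ν ∧
    IsMinOn (fun m' : Measure (E d × E d) => InformationTheory.klDiv m' (μ.prod ν)) (MT μ ν) m

/-- `∫ x̄ · y dπ`. -/
noncomputable def crossMoment (π : Measure (E d × E d)) : ℝ :=
  ∫ p, inner ℝ p.1 p.2 ∂π

/-- The maximal covariance of `η` and `μ`. -/
noncomputable def MCov (η μ : Measure (E d)) : EReal :=
  ⨆ π ∈ Cpl η μ, (crossMoment π : EReal)

/-- The objective `H(π | η ⊗ ν) - ∫ x̄ · y dπ` of the Schrödinger problem `SP(η, ν)`. -/
noncomputable def spObjective (η ν : Measure (E d)) (π : Measure (E d × E d)) : EReal :=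
  (InformationTheory.klDiv π (η.prod ν) : EReal) - (crossMoment π : EReal)

/-- The value of the Schrödinger problem `SP(η, ν)`. -/
noncomputable def spValue (η ν : Measure (E d)) : EReal :=
  ⨅ π ∈ Cpl η ν, spObjective η ν π

/-- `π` solves the Schrödinger problem `SP(η, ν)`. -/
def SolvesSP (η ν : Measure (E d)) (π : Measure (E d × E d)) : Prop :=
  π ∈ Cpl η ν ∧ IsMinOn (spObjective η ν) (Cpl η ν) π

/-- The objective of the variational problem (VP). -/
noncomputable def vpObjective (μ ν η : Measure (E d)) : EReal :=
  spValue η ν + MCov η μ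

/-- `η` solves the variational problem (VP): it maximises `vpObjective` over `P2`. -/
def SolvesVP (μ ν η : Measure (E d)) : Prop :=
  η ∈ P2 d ∧ IsMaxOn (vpObjective μ ν) (P2 d) η

/-- `log ∫ exp(k · y + ψ(y)) ν(dy)`. The integral is finite wherever this is used: `ν` has all
exponential moments and `ψ` grows at most linearly. -/
noncomputable def logPartition (ν : Measure (E d)) (ψ : E d → ℝ) (k : E d) : ℝ :=
  Real.log (∫ y, Real.exp (inner ℝ k y + ψ y) ∂ν)

/-- The objective `k ↦ k · x - log ∫ exp(k · y + ψ(y)) ν(dy)` of the inner problem `(I_x)`. -/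
noncomputable def innerObjective (ν : Measure (E d)) (ψ : E d → ℝ) (x k : E d) : ℝ :=
  inner ℝ k x - logPartition ν ψ k

/-- `k` is the unique solution of the inner problem `(I_x)`. -/
def IsUniqueInnerSolution (ν : Measure (E d)) (ψ : E d → ℝ) (x k : E d) : Prop :=
  (∀ k', innerObjective ν ψ x k' ≤ innerObjective ν ψ x k) ∧
    ∀ l, (∀ k', innerObjective ν ψ x k' ≤ innerObjective ν ψ x l) → l = k

/-- The dual functional
`𝒟(ψ) = ∫ ψ dν + ∫ sup_k [k · x - log ∫ exp(k · y + ψ(y)) ν(dy)] μ(dx)`. -/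
noncomputable def dualObjective (μ ν : Measure (E d)) (ψ : E d → ℝ) : EReal :=
  ((∫ y, ψ y ∂ν : ℝ) : EReal) +
    extIntegral (fun x => ⨆ k : E d, (innerObjective ν ψ x k : EReal)) μ

/-- The value of the dual problem (D): the supremum of `𝒟` over bounded continuous functions. -/
noncomputable def dualValue (μ ν : Measure (E d)) : EReal :=
  ⨆ ψ : BoundedContinuousFunction (E d) ℝ, dualObjective μ ν ψ

/-- `(φ, ψ)` are Schrödinger potentials for `(η, ν)`: they solve the Schrödinger system. -/
def IsSchrodingerPotentials (η ν : Measure (E d)) (φ ψ : E d → ℝ) : Prop :=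
  (∀ᵐ x ∂η, ∫ y, Real.exp (φ x + ψ y + inner ℝ x y) ∂ν = 1) ∧
    ∀ᵐ y ∂ν, ∫ x, Real.exp (φ x + ψ y + inner ℝ x y) ∂η = 1

/-- The measure with density `exp(φ(x̄) + ψ(y) + x̄ · y)` with respect to `η ⊗ ν`. -/
noncomputable def potentialPlan (η ν : Measure (E d)) (φ ψ : E d → ℝ) : Measure (E d × E d) :=
  (η.prod ν).withDensity fun p => ENNReal.ofReal (Real.exp (φ p.1 + ψ p.2 + inner ℝ p.1 p.2))

/-- The Gibbs measure with density `exp(k · y + ψ(y)) / ∫ exp(k · z + ψ(z)) ν(dz)` with respect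
to `ν`. -/
noncomputable def gibbs (ν : Measure (E d)) (ψ : E d → ℝ) (k : E d) : Measure (E d) :=
  ν.tilted fun y => inner ℝ k y + ψ y

/-- The measure `m(dx, dy) = μ(dx) m_x(dy)`, where `m_x` is the Gibbs measure with parameter
`h(x)`. -/
noncomputable def gibbsPlan (μ ν : Measure (E d)) (ψ : E d → ℝ) (h : E d → E d) :
    Measure (E d × E d) :=
  μ.bind fun x => (gibbs ν ψ (h x)).map fun y => (x, y)

end MSB

/-!
The potential `ψ` generates the exponential family of Gibbs measures
`exp(k · y + ψ(y) - log Z(k)) ν(dy)`, and `k ↦ log Z(k)` is finite, differentiable and, because `ν`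
is not carried by a hyperplane, strictly convex. Hence a maximiser `h(x)` of the inner problem is a
parameter whose Gibbs measure has mean `x` (`gibbsMean_eq_of_isMax`), and the mean determines the
parameter (`gibbsMean_injective`). An injective measurable map between Polish spaces is a measurable
embedding, so `h`, being its inverse, agrees almost everywhere with a measurable map.

The plan `m(dx, dy) = μ(dx) m_x(dy)` is therefore a martingale kernel applied to `μ`. That its second
marginal is `ν` is the first-order condition of the dual problem: replacing `ψ` by `ψ + ε 1_S` while
keeping the inner variable `h(x)` cannot beat the optimal value, and `ε → 0` gives
`ν(S) ≤ ∫ m_x(S) μ(dx)`, hence equality of two probability measures (`snd_plan`). The perturbed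
potential is not bounded and continuous, but the dual value still dominates it by approximation
(`le_dualValue`).

Write `D` for the dual value. The entropy of `m` is `D` (`klDiv_plan_eq`), and by the easy half of the
Donsker–Varadhan formula (`coe_integral_le_klDiv`) every martingale coupling has entropy at least `D`
(`le_klDiv_of_mem_MT`). So `m` solves the primal problem.

The image of `m` under `(x, y) ↦ (h(x), y)` is the coupling `π`, whose two marginal conditions are
the Schrödinger system. If `h` is square integrable, the same entropy bound shows that `π` is optimal,
with value `D - ∫ h(x) · x μ(dx)` (`spObjective_bounds`). Since `(h(X), X)` is a coupling, the law of
`h` has objective at least `D` in the variational problem. Conversely no `η` exceeds `D`: gluing any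
coupling of `η` and `μ` with `m` along `μ` gives a competitor in the Schrödinger problem for `η`
(`spValue_add_crossMoment_le`, by the data processing inequality).
-/

namespace MSB

open scoped ENNReal

variable {d : ℕ}

/-! ### The exponential family generated by a potential -/

/-- The reference measure has all exponential moments and `ψ` is a measurable potential of at most
linear growth. Growth is required at every point; an almost everywhere bound can be upgraded by
changing `ψ` on a null set. -/
structure Admissible (ν : Measure (E d)) (ψ : E d → ℝ) : Prop where
  measurable : Measurable ψ
  growth : ∃ a b : ℝ, 0 ≤ a ∧ 0 ≤ b ∧ ∀ y, |ψ y| ≤ a + b * ‖y‖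
  expMoments : ∀ q : ℝ, 0 ≤ q → Integrable (fun y => Real.exp (q * ‖y‖)) ν

/-- The density `exp(k · y + ψ(y) - log Z(k))` of the Gibbs measure with parameter `k`. -/
noncomputable def gibbsDensity (ν : Measure (E d)) (ψ : E d → ℝ) (k y : E d) : ℝ :=
  Real.exp (inner ℝ k y + ψ y - logPartition ν ψ k)

/-- The mean of the Gibbs measure with parameter `k`. -/
noncomputable def gibbsMean (ν : Measure (E d)) (ψ : E d → ℝ) (k : E d) : E d :=
  ∫ y, gibbsDensity ν ψ k y • y ∂ν

/-- The measure `ρ(dx) m_x(dy)`, with `m_x` the Gibbs measure of parameter `h(x)`, written through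
its density with respect to `ρ ⊗ ν`. The first space `α` is arbitrary, since the construction is
also applied to a coupling `ρ`. -/
noncomputable def plan {α : Type*} [MeasurableSpace α] (ρ : Measure α) (ν : Measure (E d))
    (ψ : E d → ℝ) (h : α → E d) : Measure (α × E d) :=
  (ρ.prod ν).withDensity fun p => ENNReal.ofReal (gibbsDensity ν ψ (h p.1) p.2)

variable {μ ν : Measure (E d)} {ψ : E d → ℝ}

lemma gibbsDensity_pos (k y : E d) : 0 < gibbsDensity ν ψ k y := Real.exp_pos _

lemma gibbsDensity_nonneg (k y : E d) : 0 ≤ gibbsDensity ν ψ k y := (Real.exp_pos _).le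

/-- Shifting the parameter by `u` multiplies the Gibbs density by `exp(u · y)`, up to the quotient
of the normalising constants. -/
lemma gibbsDensity_mul_exp (k u y : E d) :
    gibbsDensity ν ψ k y * Real.exp (inner ℝ u y) =
      Real.exp (logPartition ν ψ (k + u) - logPartition ν ψ k) * gibbsDensity ν ψ (k + u) y := by
  simp only [gibbsDensity, ← Real.exp_add, inner_add_left]
  ring_nf

lemma exp_potentials_eq_gibbsDensity (x y : E d) :
    Real.exp (-Real.log (∫ y, Real.exp (ψ y + inner ℝ x y) ∂ν) + ψ y + inner ℝ x y) =
      gibbsDensity ν ψ x y := by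
  simp only [gibbsDensity, logPartition, add_comm (inner ℝ _ _) (ψ _)]
  ring_nf

namespace Admissible

lemma exists_exp_le (A : Admissible ν ψ) :
    ∃ a b : ℝ, 0 ≤ a ∧ 0 ≤ b ∧ (∀ y, |ψ y| ≤ a + b * ‖y‖) ∧
      ∀ k y, Real.exp (inner ℝ k y + ψ y) ≤ Real.exp a * Real.exp ((‖k‖ + b) * ‖y‖) := by
  obtain ⟨a, b, ha, hb, hab⟩ := A.growth
  refine ⟨a, b, ha, hb, hab, fun k y => ?_⟩
  rw [← Real.exp_add]
  apply Real.exp_le_exp.mpr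
  have h1 := (abs_le.mp (abs_real_inner_le_norm k y)).2
  have h2 := (abs_le.mp (hab y)).2
  linarith

/-- Everything of exponential growth is integrable against the Gibbs weights. -/
lemma integrable_exp_smul (A : Admissible ν ψ) {F : Type*} [NormedAddCommGroup F] [NormedSpace ℝ F]
    (k : E d) {f : E d → F} (hf : AEStronglyMeasurable f ν) {C q : ℝ} (hq : 0 ≤ q)
    (hfC : ∀ y, ‖f y‖ ≤ C * Real.exp (q * ‖y‖)) :
    Integrable (fun y => Real.exp (inner ℝ k y + ψ y) • f y) ν := by
  obtain ⟨a, b, ha, hb, -, hab⟩ := A.exists_exp_le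
  have hm := A.measurable
  refine ((A.expMoments (‖k‖ + b + q) (by positivity)).const_mul (Real.exp a * C)).mono'
    (AEStronglyMeasurable.smul (by fun_prop) hf) (ae_of_all _ fun y => ?_)
  rw [norm_smul, Real.norm_of_nonneg (Real.exp_pos _).le]
  calc _ ≤ (Real.exp a * Real.exp ((‖k‖ + b) * ‖y‖)) * (C * Real.exp (q * ‖y‖)) :=
        mul_le_mul (hab k y) (hfC y) (norm_nonneg _) (by positivity)
    _ = _ := by
        rw [show (‖k‖ + b + q) * ‖y‖ = (‖k‖ + b) * ‖y‖ + q * ‖y‖ by ring, Real.exp_add]; ring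

lemma integrable_exp (A : Admissible ν ψ) (k : E d) :
    Integrable (fun y => Real.exp (inner ℝ k y + ψ y)) ν := by
  simpa using A.integrable_exp_smul k (f := fun _ => (1 : ℝ)) (by fun_prop) le_rfl (C := 1) (by simp)

lemma gibbsDensity_eq (A : Admissible ν ψ) [NeZero ν] (k y : E d) :
    gibbsDensity ν ψ k y =
      Real.exp (inner ℝ k y + ψ y) / ∫ z, Real.exp (inner ℝ k z + ψ z) ∂ν := by
  rw [gibbsDensity, Real.exp_sub, logPartition, Real.exp_log (integral_exp_pos (A.integrable_exp k))]

lemma integrable_gibbsDensity_smul (A : Admissible ν ψ) [NeZero ν] {F : Type*}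
    [NormedAddCommGroup F] [NormedSpace ℝ F]
    (k : E d) {f : E d → F} (hf : AEStronglyMeasurable f ν) {C q : ℝ} (hq : 0 ≤ q)
    (hfC : ∀ y, ‖f y‖ ≤ C * Real.exp (q * ‖y‖)) :
    Integrable (fun y => gibbsDensity ν ψ k y • f y) ν := by
  refine ((A.integrable_exp_smul k hf hq hfC).smul
    (∫ z, Real.exp (inner ℝ k z + ψ z) ∂ν)⁻¹).congr (ae_of_all _ fun y => ?_)
  simp only [Pi.smul_apply, A.gibbsDensity_eq, smul_smul, div_eq_inv_mul]

lemma integrable_gibbsDensity (A : Admissible ν ψ) [NeZero ν] (k : E d) :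
    Integrable (gibbsDensity ν ψ k) ν := by
  simpa using A.integrable_gibbsDensity_smul k (f := fun _ => (1 : ℝ)) (by fun_prop) le_rfl (C := 1)
    (by simp)

lemma integrable_gibbsDensity_smul_self (A : Admissible ν ψ) [NeZero ν] (k : E d) :
    Integrable (fun y => gibbsDensity ν ψ k y • y) ν :=
  A.integrable_gibbsDensity_smul k (f := fun y => y) (by fun_prop) zero_le_one (C := 1)
    fun y => by simpa using (Real.add_one_le_exp ‖y‖).trans' (by linarith)

lemma integrable_gibbsDensity_mul_inner (A : Admissible ν ψ) [NeZero ν] (k u : E d) :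
    Integrable (fun y => gibbsDensity ν ψ k y * inner ℝ u y) ν := by
  refine ((A.integrable_gibbsDensity_smul_self k).const_inner u).congr (ae_of_all _ fun y => ?_)
  simp [inner_smul_right]

lemma integral_gibbsDensity_mul_inner (A : Admissible ν ψ) [NeZero ν] (k u : E d) :
    ∫ y, gibbsDensity ν ψ k y * inner ℝ u y ∂ν = inner ℝ u (gibbsMean ν ψ k) := by
  rw [gibbsMean, ← integral_inner (A.integrable_gibbsDensity_smul_self k)]
  simp [inner_smul_right]

lemma integral_gibbsDensity (A : Admissible ν ψ) [NeZero ν] (k : E d) :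
    ∫ y, gibbsDensity ν ψ k y ∂ν = 1 := by
  simp_rw [A.gibbsDensity_eq, integral_div]
  exact div_self (integral_exp_pos (A.integrable_exp k)).ne'

lemma lintegral_gibbsDensity (A : Admissible ν ψ) [NeZero ν] (k : E d) :
    ∫⁻ y, ENNReal.ofReal (gibbsDensity ν ψ k y) ∂ν = 1 := by
  rw [← ofReal_integral_eq_lintegral_ofReal (A.integrable_gibbsDensity k)
    (ae_of_all _ (gibbsDensity_nonneg k)), A.integral_gibbsDensity, ENNReal.ofReal_one]

lemma integral_gibbsDensity_mul_exp (A : Admissible ν ψ) [NeZero ν] (k u : E d) :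
    ∫ y, gibbsDensity ν ψ k y * Real.exp (inner ℝ u y) ∂ν =
      Real.exp (logPartition ν ψ (k + u) - logPartition ν ψ k) := by
  simp_rw [gibbsDensity_mul_exp, integral_const_mul, A.integral_gibbsDensity, mul_one]

lemma measurable_logPartition (A : Admissible ν ψ) [SFinite ν] :
    Measurable (logPartition ν ψ) := by
  have hm := A.measurable
  have : StronglyMeasurable fun k : E d => ∫ y, Real.exp (inner ℝ k y + ψ y) ∂ν :=
    StronglyMeasurable.integral_prod_right'
      (f := fun p : E d × E d => Real.exp (inner ℝ p.1 p.2 + ψ p.2))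
      (Measurable.stronglyMeasurable (by fun_prop))
  exact Real.measurable_log.comp this.measurable

lemma measurable_gibbsDensity (A : Admissible ν ψ) [SFinite ν] {α : Type*} [MeasurableSpace α]
    {f g : α → E d} (hf : Measurable f) (hg : Measurable g) :
    Measurable fun p => gibbsDensity ν ψ (f p) (g p) := by
  have hm := A.measurable
  have hl := A.measurable_logPartition
  unfold gibbsDensity
  fun_prop

lemma measurable_gibbsMean (A : Admissible ν ψ) [SFinite ν] : Measurable (gibbsMean ν ψ) := by
  have := A.measurable_gibbsDensity (measurable_fst (α := E d) (β := E d)) measurable_snd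
  exact (StronglyMeasurable.integral_prod_right'
    (f := fun p : E d × E d => gibbsDensity ν ψ p.1 p.2 • p.2)
    (this.smul measurable_snd).stronglyMeasurable).measurable

/-- With `s = u · (y - gibbsMean k)`, the Gibbs integral of `exp s - 1 - s ≥ 0` measures the gap in
the convexity inequality of the log-partition function between `k` and `k + u`. -/
lemma integral_exp_sub_one_sub (A : Admissible ν ψ) [NeZero ν] (k u : E d) :
    Integrable (fun y => gibbsDensity ν ψ k y * (Real.exp (inner ℝ u (y - gibbsMean ν ψ k))
      - 1 - inner ℝ u (y - gibbsMean ν ψ k))) ν ∧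
    ∫ y, gibbsDensity ν ψ k y * (Real.exp (inner ℝ u (y - gibbsMean ν ψ k))
      - 1 - inner ℝ u (y - gibbsMean ν ψ k)) ∂ν =
    Real.exp (logPartition ν ψ (k + u) - logPartition ν ψ k - inner ℝ u (gibbsMean ν ψ k)) - 1 := by
  set T := gibbsMean ν ψ k with hT
  have e : ∀ y, gibbsDensity ν ψ k y * (Real.exp (inner ℝ u (y - T)) - 1 - inner ℝ u (y - T)) =
      Real.exp (-inner ℝ u T) * (gibbsDensity ν ψ k y * Real.exp (inner ℝ u y))
        - (1 - inner ℝ u T) * gibbsDensity ν ψ k y - gibbsDensity ν ψ k y * inner ℝ u y := by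
    intro y
    rw [inner_sub_right, sub_eq_add_neg (inner ℝ u y), Real.exp_add]; ring
  have i1 : Integrable (fun y => gibbsDensity ν ψ k y * Real.exp (inner ℝ u y)) ν := by
    simp_rw [gibbsDensity_mul_exp]
    exact (A.integrable_gibbsDensity _).const_mul _
  have i2 := A.integrable_gibbsDensity k
  have i3 := A.integrable_gibbsDensity_mul_inner k u
  simp_rw [e]
  have i4 : Integrable (fun y => Real.exp (-inner ℝ u T) *
      (gibbsDensity ν ψ k y * Real.exp (inner ℝ u y)) - (1 - inner ℝ u T) * gibbsDensity ν ψ k y) ν :=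
    (i1.const_mul _).sub (i2.const_mul _)
  refine ⟨i4.sub i3, ?_⟩
  rw [integral_sub i4 i3,
    integral_sub (i1.const_mul _) (i2.const_mul _), integral_const_mul, integral_const_mul,
    A.integral_gibbsDensity, A.integral_gibbsDensity_mul_inner, A.integral_gibbsDensity_mul_exp,
    ← hT, ← Real.exp_add]
  ring_nf

/-- Strict convexity of the log-partition function: if `ν` is not carried by a hyperplane, then the
mean determines the parameter of the Gibbs measure. -/
lemma gibbsMean_injective (A : Admissible ν ψ) [NeZero ν]
    (H2 : ∀ u : E d, u ≠ 0 → ∀ α : ℝ, ¬ ∀ᵐ y ∂ν, inner ℝ u y = α) :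
    Function.Injective (gibbsMean ν ψ) := by
  intro k l hkl
  by_contra hne
  have hu : l - k ≠ 0 := sub_ne_zero.mpr (Ne.symm hne)
  obtain ⟨i1, e1⟩ := A.integral_exp_sub_one_sub k (l - k)
  obtain ⟨i2, e2⟩ := A.integral_exp_sub_one_sub l (k - l)
  have nn : ∀ k u y, 0 ≤ gibbsDensity ν ψ k y * (Real.exp (inner ℝ u (y - gibbsMean ν ψ k))
      - 1 - inner ℝ u (y - gibbsMean ν ψ k)) := fun k u y =>
    mul_nonneg (gibbsDensity_nonneg _ _) (by
      have := Real.add_one_le_exp (inner ℝ u (y - gibbsMean ν ψ k)); linarith)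
  have p1 := e1 ▸ integral_nonneg (μ := ν) (nn k (l - k))
  have p2 := e2 ▸ integral_nonneg (μ := ν) (nn l (k - l))
  rw [add_sub_cancel, sub_nonneg, Real.one_le_exp_iff] at p1 p2
  rw [← hkl, ← neg_sub l k, inner_neg_left] at p2
  have z : ∫ y, gibbsDensity ν ψ k y * (Real.exp (inner ℝ (l - k) (y - gibbsMean ν ψ k))
      - 1 - inner ℝ (l - k) (y - gibbsMean ν ψ k)) ∂ν = 0 := by
    rw [e1, add_sub_cancel, show logPartition ν ψ l - logPartition ν ψ k
      - inner ℝ (l - k) (gibbsMean ν ψ k) = 0 by linarith, Real.exp_zero, sub_self]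
  rw [integral_eq_zero_iff_of_nonneg (nn k (l - k)) i1] at z
  refine H2 (l - k) hu (inner ℝ (l - k) (gibbsMean ν ψ k)) ?_
  filter_upwards [z] with y hy
  have h1 := (mul_eq_zero.mp hy).resolve_left (gibbsDensity_pos _ _).ne'
  by_contra h2
  have h3 : inner ℝ (l - k) (y - gibbsMean ν ψ k) ≠ 0 := by
    rw [inner_sub_right]; exact sub_ne_zero.mpr h2
  have := Real.add_one_lt_exp h3
  linarith

/-- First-order condition for the inner problem: at a maximiser of `k ↦ k · x - log Z(k)` the mean
of the Gibbs measure is `x`. -/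
lemma gibbsMean_eq_of_isMax (A : Admissible ν ψ) [NeZero ν] {x k : E d}
    (hk : ∀ k', innerObjective ν ψ x k' ≤ innerObjective ν ψ x k) : gibbsMean ν ψ k = x := by
  refine ext_inner_left ℝ fun u => ?_
  have hm := A.measurable
  -- the moment generating function of `u · y` under the Gibbs measure with parameter `k`
  set P : Measure (E d) := ν.tilted fun y => inner ℝ k y + ψ y with hP
  have hint : ∀ f : E d → ℝ, ∫ y, f y ∂P = ∫ y, gibbsDensity ν ψ k y * f y ∂ν := fun f => by
    rw [hP, integral_tilted]; simp [A.gibbsDensity_eq]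
  have hset : ProbabilityTheory.integrableExpSet (fun y => inner ℝ u y) P = Set.univ := by
    refine Set.eq_univ_of_forall fun t => ?_
    rw [ProbabilityTheory.integrableExpSet, Set.mem_ofPred_eq, hP,
      integrable_tilted_iff (A.integrable_exp k)]
    refine (A.integrable_exp (k + t • u)).congr (ae_of_all _ fun y => ?_)
    simp only [smul_eq_mul, ← Real.exp_add, inner_add_left, inner_smul_left, conj_trivial]
    ring_nf
  have hmgf : ∀ t, ProbabilityTheory.mgf (fun y => inner ℝ u y) P t =
      Real.exp (logPartition ν ψ (k + t • u) - logPartition ν ψ k) := fun t => by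
    rw [ProbabilityTheory.mgf, hint, ← A.integral_gibbsDensity_mul_exp]
    simp [inner_smul_left]
  have h1 : HasDerivAt (ProbabilityTheory.mgf (fun y => inner ℝ u y) P)
      (inner ℝ u (gibbsMean ν ψ k)) 0 := by
    have := ProbabilityTheory.hasDerivAt_mgf (X := fun y : E d => inner ℝ u y) (μ := P) (t := 0)
      (by rw [hset, interior_univ]; trivial)
    rw [hint] at this
    simpa [A.integral_gibbsDensity_mul_inner] using this
  have h2 : HasDerivAt (fun t : ℝ => Real.exp (t * inner ℝ u x)) (inner ℝ u x) 0 := by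
    simpa using ((hasDerivAt_id (0 : ℝ)).mul_const (inner ℝ u x)).exp
  have hmin : IsLocalMin (fun t => ProbabilityTheory.mgf (fun y => inner ℝ u y) P t
      - Real.exp (t * inner ℝ u x)) 0 := by
    refine Filter.Eventually.of_forall fun t => ?_
    simp only [hmgf, zero_smul, add_zero, sub_self, zero_mul, Real.exp_zero]
    rw [sub_nonneg]
    apply Real.exp_le_exp.mpr
    have := hk (k + t • u)
    simp only [innerObjective, inner_add_left, inner_smul_left, conj_trivial] at this
    linarith
  have := hmin.hasDerivAt_eq_zero (h1.sub h2)
  linarith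

lemma gibbs_eq_withDensity (A : Admissible ν ψ) [NeZero ν] (k : E d) :
    gibbs ν ψ k = ν.withDensity fun y => ENNReal.ofReal (gibbsDensity ν ψ k y) := by
  simp_rw [gibbs, Measure.tilted, A.gibbsDensity_eq]

lemma gibbsPlan_eq_plan (A : Admissible ν ψ) [NeZero ν] [SFinite ν] [SFinite μ] {h : E d → E d}
    (hh : Measurable h) : gibbsPlan μ ν ψ h = plan μ ν ψ h := by
  have hm : Measurable fun p : E d × E d => ENNReal.ofReal (gibbsDensity ν ψ (h p.1) p.2) :=
    (A.measurable_gibbsDensity (hh.comp measurable_fst) measurable_snd).ennreal_ofReal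
  have key : ∀ S : Set (E d × E d), MeasurableSet S → ∀ x,
      ((gibbs ν ψ (h x)).map fun y => (x, y)) S =
        ∫⁻ y, S.indicator (fun p => ENNReal.ofReal (gibbsDensity ν ψ (h p.1) p.2)) (x, y) ∂ν := by
    intro S hS x
    rw [Measure.map_apply (by fun_prop) hS, A.gibbs_eq_withDensity,
      withDensity_apply _ (measurable_prodMk_left hS), ← lintegral_indicator (measurable_prodMk_left hS)]
    rfl
  have hker : Measurable fun x => (gibbs ν ψ (h x)).map fun y => (x, y) := by
    refine Measure.measurable_of_measurable_coe _ fun S hS => ?_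
    simp_rw [key S hS]
    exact (hm.indicator hS).lintegral_prod_right'
  ext S hS
  rw [gibbsPlan, Measure.bind_apply hS hker.aemeasurable, plan, withDensity_apply _ hS,
    ← lintegral_indicator hS, lintegral_prod _ (hm.indicator hS).aemeasurable]
  simp_rw [key S hS]

end Admissible

lemma potentialPlan_eq_plan (η : Measure (E d)) :
    potentialPlan η ν (fun x => -Real.log (∫ y, Real.exp (ψ y + inner ℝ x y) ∂ν)) ψ =
      plan η ν ψ id := by
  rw [potentialPlan, plan]
  congr 1
  ext p
  simp only [gibbsDensity, logPartition, id, add_comm (inner ℝ _ _) (ψ _)]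
  congr 2
  ring

/-! ### The extended integral -/

lemma extIntegral_mono {α : Type*} [MeasurableSpace α] {ρ : Measure α} {f g : α → EReal}
    (hfg : ∀ᵐ x ∂ρ, f x ≤ g x) : extIntegral f ρ ≤ extIntegral g ρ := by
  refine EReal.sub_le_sub ?_ ?_ <;> refine EReal.coe_ennreal_le_coe_ennreal_iff.mpr ?_
  · exact lintegral_mono_ae (hfg.mono fun x hx => EReal.toENNReal_le_toENNReal hx)
  · exact lintegral_mono_ae (hfg.mono fun x hx =>
      EReal.toENNReal_le_toENNReal (EReal.neg_le_neg_iff.mpr hx))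

lemma extIntegral_congr {α : Type*} [MeasurableSpace α] {ρ : Measure α} {f g : α → EReal}
    (hfg : ∀ᵐ x ∂ρ, f x = g x) : extIntegral f ρ = extIntegral g ρ :=
  le_antisymm (extIntegral_mono (hfg.mono fun _ h => h.le))
    (extIntegral_mono (hfg.mono fun _ h => h.ge))

lemma extIntegral_coe {α : Type*} [MeasurableSpace α] {ρ : Measure α} {f : α → ℝ}
    (hf : Integrable f ρ) : extIntegral (fun x => (f x : EReal)) ρ = ((∫ x, f x ∂ρ : ℝ) : EReal) := by
  have h1 : ∫⁻ x, ENNReal.ofReal (f x) ∂ρ ≠ ⊤ := hf.lintegral_lt_top.ne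
  have h2 : ∫⁻ x, ENNReal.ofReal (-f x) ∂ρ ≠ ⊤ := hf.neg.lintegral_lt_top.ne
  rw [integral_eq_lintegral_pos_part_sub_lintegral_neg_part hf, EReal.coe_sub,
    EReal.coe_ennreal_toReal h1, EReal.coe_ennreal_toReal h2]
  rfl

/-! ### First variation of the dual functional -/

namespace Admissible

lemma integrable_linear (A : Admissible ν ψ) [IsFiniteMeasure ν] (a b : ℝ) :
    Integrable (fun y => a + b * ‖y‖) ν := by
  have h1 : Integrable (fun y : E d => ‖y‖) ν := by
    refine (A.expMoments 1 zero_le_one).mono' (by fun_prop) (ae_of_all _ fun y => ?_)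
    have := Real.add_one_le_exp ‖y‖
    rw [norm_norm, one_mul]
    linarith
  exact (integrable_const a).add (h1.const_mul b)

lemma integrable (A : Admissible ν ψ) [IsFiniteMeasure ν] : Integrable ψ ν := by
  obtain ⟨a, b, -, -, hab⟩ := A.growth
  exact (A.integrable_linear a b).mono' A.measurable.aestronglyMeasurable (ae_of_all _ hab)

/-- A potential of linear growth is the almost everywhere limit of bounded continuous potentials
obeying the same growth bound. -/
lemma exists_boundedContinuous_tendsto (A : Admissible ν ψ) [IsProbabilityMeasure ν] {a b : ℝ}
    (ha : 0 ≤ a) (hb : 0 ≤ b) (hab : ∀ y, |ψ y| ≤ a + b * ‖y‖) :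
    ∃ f : ℕ → BoundedContinuousFunction (E d) ℝ, (∀ n y, |f n y| ≤ a + b * ‖y‖) ∧
      ∀ᵐ y ∂ν, Filter.Tendsto (fun n => f n y) Filter.atTop (nhds (ψ y)) := by
  have hL : MemLp ψ 1 ν := memLp_one_iff_integrable.mpr A.integrable
  have hex : ∀ n : ℕ, ∃ φ : BoundedContinuousFunction (E d) ℝ,
      eLpNorm (ψ - (φ : E d → ℝ)) 1 ν ≤ ENNReal.ofReal (1 / ((n : ℝ) + 1)) := fun n => by
    obtain ⟨φ, h, -⟩ := hL.exists_boundedContinuous_eLpNorm_sub_le ENNReal.one_ne_top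
      (ε := ENNReal.ofReal (1 / ((n : ℝ) + 1))) (by
        have : (0 : ℝ) < 1 / ((n : ℝ) + 1) := by positivity
        simpa using this)
    exact ⟨φ, h⟩
  choose φ hφ using hex
  have hlim : Filter.Tendsto (fun n => eLpNorm ((φ n : E d → ℝ) - ψ) 1 ν) Filter.atTop (nhds 0) := by
    refine tendsto_of_tendsto_of_tendsto_of_le_of_le tendsto_const_nhds ?_ (fun _ => zero_le)
      (fun n => (eLpNorm_sub_comm _ _ _ _).trans_le (hφ n))
    simpa using ENNReal.tendsto_ofReal tendsto_one_div_add_atTop_nhds_zero_nat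
  obtain ⟨ns, -, hns⟩ := (tendstoInMeasure_of_tendsto_eLpNorm one_ne_zero
    (fun n => (φ n).continuous.aestronglyMeasurable) A.measurable.aestronglyMeasurable
      hlim).exists_seq_tendsto_ae
  have hc : ∀ y : E d, 0 ≤ a + b * ‖y‖ := fun y => by positivity
  -- clamping to the growth bound keeps the limit, the continuity and the boundedness
  refine ⟨fun n => BoundedContinuousFunction.ofNormedAddCommGroup
    (fun y => max (-(a + b * ‖y‖)) (min (φ (ns n) y) (a + b * ‖y‖))) (by fun_prop) ‖φ (ns n)‖ ?_,
    fun n y => ?_, ?_⟩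
  · intro y
    have h1 := abs_le.mp ((φ (ns n)).norm_coe_le_norm y)
    rw [Real.norm_eq_abs, abs_le]
    have := hc y
    constructor
    · exact le_max_of_le_right (le_min h1.1 (by linarith [norm_nonneg (φ (ns n))]))
    · exact max_le (by linarith [norm_nonneg (φ (ns n))]) ((min_le_left _ _).trans h1.2)
  · have := hc y
    exact abs_le.mpr ⟨le_max_left _ _, max_le (by linarith) (min_le_right _ _)⟩
  · filter_upwards [hns] with y hy
    have h1 := abs_le.mp (hab y)
    have h2 := (tendsto_const_nhds (x := -(a + b * ‖y‖))).max
      (hy.min (tendsto_const_nhds (x := a + b * ‖y‖)))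
    rwa [min_eq_left h1.2, max_eq_right h1.1] at h2

lemma measurable_innerObjective (A : Admissible ν ψ) [SFinite ν] {h : E d → E d}
    (hh : Measurable h) : Measurable fun x => innerObjective ν ψ x (h x) := by
  have hl := A.measurable_logPartition
  unfold innerObjective
  fun_prop

lemma logPartition_zero_le (A : Admissible ν ψ) [NeZero ν] {a b : ℝ} (hb : 0 ≤ b)
    (hab : ∀ y, |ψ y| ≤ a + b * ‖y‖) :
    logPartition ν ψ 0 ≤ Real.log (∫ y, Real.exp a * Real.exp (b * ‖y‖) ∂ν) := by
  refine Real.log_le_log (integral_exp_pos (A.integrable_exp 0))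
    (integral_mono (A.integrable_exp 0) ((A.expMoments b hb).const_mul _) fun y => ?_)
  simp only [← Real.exp_add, inner_zero_left, zero_add]
  exact Real.exp_le_exp.mpr (abs_le.mp (hab y)).2

lemma tendsto_logPartition (A : Admissible ν ψ) [NeZero ν] {a b : ℝ} (hb : 0 ≤ b)
    {f : ℕ → E d → ℝ} (hf : ∀ n, Measurable (f n)) (hab : ∀ n y, |f n y| ≤ a + b * ‖y‖)
    (hlim : ∀ᵐ y ∂ν, Filter.Tendsto (fun n => f n y) Filter.atTop (nhds (ψ y))) (k : E d) :
    Filter.Tendsto (fun n => logPartition ν (f n) k) Filter.atTop (nhds (logPartition ν ψ k)) := by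
  refine Filter.Tendsto.log ?_ (integral_exp_pos (A.integrable_exp k)).ne'
  refine tendsto_integral_of_dominated_convergence
    (fun y => Real.exp a * Real.exp ((‖k‖ + b) * ‖y‖)) (fun n => ?_)
    ((A.expMoments _ (by positivity)).const_mul _) (fun n => ae_of_all _ fun y => ?_) ?_
  · have := hf n
    exact (Measurable.aestronglyMeasurable (by fun_prop))
  · rw [Real.norm_of_nonneg (Real.exp_pos _).le, ← Real.exp_add]
    apply Real.exp_le_exp.mpr
    have h1 := (abs_le.mp (abs_real_inner_le_norm k y)).2
    have h2 := (abs_le.mp (hab n y)).2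
    linarith
  · filter_upwards [hlim] with y hy
    exact (Real.continuous_exp.tendsto _).comp (hy.const_add _)

/-- The dual value, a supremum over bounded continuous potentials, also dominates the dual
functional at potentials of linear growth, even when the inner supremum is replaced by the value
at an arbitrary measurable choice of the inner variable. -/
lemma le_dualValue (A : Admissible ν ψ) [IsProbabilityMeasure ν] [IsProbabilityMeasure μ]
    {k : E d → E d} (hk : Measurable k)
    (hL : Integrable (fun x => innerObjective ν ψ x (k x)) μ) :
    ((∫ y, ψ y ∂ν + ∫ x, innerObjective ν ψ x (k x) ∂μ : ℝ) : EReal) ≤ dualValue μ ν := by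
  obtain ⟨a, b, ha, hb, hab⟩ := A.growth
  obtain ⟨f, hf, hlim⟩ := A.exists_boundedContinuous_tendsto ha hb hab
  have Af : ∀ n, Admissible ν (f n) := fun n =>
    ⟨(f n).continuous.measurable, ⟨a, b, ha, hb, hf n⟩, A.expMoments⟩
  set c := Real.log (∫ y, Real.exp a * Real.exp (b * ‖y‖) ∂ν)
  -- the inner suprema are bounded below by `-c` uniformly in `n`, which allows dominated
  -- convergence after capping the approximants by the modulus of the limit
  let v : ℕ → E d → ℝ := fun n x =>
    max (-|c|) (min (innerObjective ν (f n) x (k x)) |innerObjective ν ψ x (k x)|)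
  have hvm : ∀ n, Measurable (v n) := fun n =>
    measurable_const.max (((Af n).measurable_innerObjective hk).min
      (measurable_norm.comp (A.measurable_innerObjective hk)))
  have hvb : ∀ n x, |v n x| ≤ |c| + |innerObjective ν ψ x (k x)| := fun n x => by
    have h1 := abs_nonneg c
    have h2 := abs_nonneg (innerObjective ν ψ x (k x))
    exact abs_le.mpr ⟨le_max_of_le_left (by linarith),
      max_le (by linarith) ((min_le_right _ _).trans (by linarith))⟩
  have hbi : Integrable (fun x => |c| + |innerObjective ν ψ x (k x)|) μ :=
    (integrable_const _).add hL.abs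
  have hvi : ∀ n, Integrable (v n) μ := fun n =>
    hbi.mono' (hvm n).aestronglyMeasurable (ae_of_all _ (hvb n))
  have hvle : ∀ n x, (v n x : EReal) ≤ ⨆ k : E d, (innerObjective ν (f n) x k : EReal) := by
    intro n x
    rcases max_choice (-|c|) (min (innerObjective ν (f n) x (k x)) |innerObjective ν ψ x (k x)|)
      with h | h
    · refine le_iSup_of_le 0 (EReal.coe_le_coe_iff.mpr ?_)
      have h1 := (Af n).logPartition_zero_le hb (hf n)
      rw [show v n x = -|c| from h, innerObjective, inner_zero_left]
      linarith [le_abs_self c]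
    · refine le_iSup_of_le (k x) (EReal.coe_le_coe_iff.mpr ?_)
      simp only [v, h]
      exact min_le_left _ _
  have hstep : ∀ n, ((∫ y, f n y ∂ν + ∫ x, v n x ∂μ : ℝ) : EReal) ≤ dualValue μ ν := by
    intro n
    refine le_trans ?_ (le_iSup (fun φ : BoundedContinuousFunction (E d) ℝ =>
      dualObjective μ ν φ) (f n))
    rw [EReal.coe_add, dualObjective, ← extIntegral_coe (hvi n)]
    gcongr
    exact extIntegral_mono (ae_of_all _ (hvle n))
  have hlim1 : Filter.Tendsto (fun n => ∫ y, f n y ∂ν) Filter.atTop (nhds (∫ y, ψ y ∂ν)) :=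
    tendsto_integral_of_dominated_convergence _
      (fun n => (f n).continuous.aestronglyMeasurable) (A.integrable_linear a b)
      (fun n => ae_of_all _ (hf n)) hlim
  have hlim2 : Filter.Tendsto (fun n => ∫ x, v n x ∂μ) Filter.atTop
      (nhds (∫ x, max (-|c|) (innerObjective ν ψ x (k x)) ∂μ)) := by
    refine tendsto_integral_of_dominated_convergence _
      (fun n => (hvm n).aestronglyMeasurable) hbi (fun n => ae_of_all _ (hvb n))
      (ae_of_all _ fun x => ?_)
    have h1 := (A.tendsto_logPartition hb (fun n => (Af n).measurable) hf hlim (k x)).const_sub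
      (inner ℝ (k x) x)
    have h2 := (tendsto_const_nhds (x := -|c|)).max
      (h1.min (tendsto_const_nhds (x := |innerObjective ν ψ x (k x)|)))
    have h3 := le_abs_self (innerObjective ν ψ x (k x))
    change Filter.Tendsto _ _ (nhds (max (-|c|) (min (innerObjective ν ψ x (k x)) _))) at h2
    rw [min_eq_left h3] at h2
    exact h2
  have hge : ∫ x, innerObjective ν ψ x (k x) ∂μ ≤
      ∫ x, max (-|c|) (innerObjective ν ψ x (k x)) ∂μ :=
    integral_mono hL ((integrable_const _).sup hL) fun x => le_max_right _ _
  refine le_trans (EReal.coe_le_coe_iff.mpr (add_le_add_right hge _)) ?_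
  exact le_of_tendsto ((continuous_coe_real_ereal.tendsto _).comp (hlim1.add hlim2))
    (Filter.Eventually.of_forall hstep)

/-- If the dual functional is finite and the inner suprema are attained at `h`, then the optimal
inner values are integrable, so that the dual functional is a sum of two genuine integrals. -/
lemma dualObjective_eq (A : Admissible ν ψ) [IsProbabilityMeasure ν] [IsProbabilityMeasure μ]
    {h : E d → E d} (hh : Measurable h)
    (hmax : ∀ᵐ x ∂μ, ∀ k, innerObjective ν ψ x k ≤ innerObjective ν ψ x (h x))
    (htop : dualObjective μ ν ψ ≠ ⊤) :
    Integrable (fun x => innerObjective ν ψ x (h x)) μ ∧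
    dualObjective μ ν ψ =
      ((∫ y, ψ y ∂ν + ∫ x, innerObjective ν ψ x (h x) ∂μ : ℝ) : EReal) := by
  have hsup : extIntegral (fun x => ⨆ k : E d, (innerObjective ν ψ x k : EReal)) μ =
      extIntegral (fun x => (innerObjective ν ψ x (h x) : EReal)) μ :=
    extIntegral_congr <| hmax.mono fun x hx => le_antisymm
      (iSup_le fun k => EReal.coe_le_coe_iff.mpr (hx k))
      (le_iSup (fun k => (innerObjective ν ψ x k : EReal)) (h x))
  have hneg : ∫⁻ x, ENNReal.ofReal (-innerObjective ν ψ x (h x)) ∂μ ≠ ⊤ := by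
    have : ∫⁻ x, ENNReal.ofReal (-innerObjective ν ψ x (h x)) ∂μ ≤
        ∫⁻ _, ENNReal.ofReal (logPartition ν ψ 0) ∂μ :=
      lintegral_mono_ae <| hmax.mono fun x hx => by
        have := hx 0
        rw [innerObjective, inner_zero_left] at this
        exact ENNReal.ofReal_le_ofReal (by linarith)
    exact ne_top_of_le_ne_top (by simp) this
  have hpos : ∫⁻ x, ENNReal.ofReal (innerObjective ν ψ x (h x)) ∂μ ≠ ⊤ := by
    intro hp
    apply htop
    rw [dualObjective, hsup, extIntegral]
    simp only [← EReal.coe_neg, EReal.real_coe_toENNReal]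
    rw [hp, EReal.coe_ennreal_top, ← ENNReal.ofReal_toReal hneg,
      EReal.coe_ennreal_ofReal, EReal.top_sub_coe, EReal.coe_add_top]
  have hint : Integrable (fun x => innerObjective ν ψ x (h x)) μ := by
    refine ⟨(A.measurable_innerObjective hh).aestronglyMeasurable, ?_⟩
    refine lt_of_le_of_lt (lintegral_mono fun x => ?_)
      ((lintegral_add_left (A.measurable_innerObjective hh).ennreal_ofReal _).trans_lt
        (ENNReal.add_lt_top.mpr ⟨hpos.lt_top, hneg.lt_top⟩))
    rw [Real.enorm_eq_ofReal_abs]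
    rcases le_total 0 (innerObjective ν ψ x (h x)) with h0 | h0
    · rw [abs_of_nonneg h0]; exact le_self_add
    · rw [abs_of_nonpos h0]; exact le_add_self
  refine ⟨hint, ?_⟩
  rw [dualObjective, hsup, extIntegral_coe hint, EReal.coe_add]

lemma setIntegral_gibbsDensity_mem (A : Admissible ν ψ) [NeZero ν] (S : Set (E d)) (k : E d) :
    0 ≤ ∫ y in S, gibbsDensity ν ψ k y ∂ν ∧ ∫ y in S, gibbsDensity ν ψ k y ∂ν ≤ 1 :=
  ⟨integral_nonneg fun y => gibbsDensity_nonneg k y,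
    (setIntegral_le_integral (A.integrable_gibbsDensity k)
      (ae_of_all _ (gibbsDensity_nonneg k))).trans_eq (A.integral_gibbsDensity k)⟩

lemma add_indicator (A : Admissible ν ψ) {S : Set (E d)} (hS : MeasurableSet S) {ε : ℝ}
    (hε : 0 ≤ ε) : Admissible ν (fun y => ψ y + S.indicator (fun _ => ε) y) := by
  obtain ⟨a, b, ha, hb, hab⟩ := A.growth
  refine ⟨A.measurable.add (measurable_const.indicator hS),
    ⟨a + ε, b, by positivity, hb, fun y => ?_⟩, A.expMoments⟩
  have h1 := abs_add_le (ψ y) (S.indicator (fun _ => ε) y)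
  have h2 : |S.indicator (fun _ => ε) y| ≤ ε := by
    by_cases hy : y ∈ S <;> simp [hy, abs_of_nonneg hε, hε]
  linarith [hab y]

/-- Raising the potential by `ε` on `S` raises the log-partition function by
`log (1 + (exp ε - 1) p)`, with `p` the Gibbs probability of `S`. -/
lemma logPartition_add_indicator (A : Admissible ν ψ) [NeZero ν] {S : Set (E d)}
    (hS : MeasurableSet S) {ε : ℝ} (hε : 0 ≤ ε) (k : E d) :
    logPartition ν (fun y => ψ y + S.indicator (fun _ => ε) y) k =
      logPartition ν ψ k +
        Real.log (1 + (Real.exp ε - 1) * ∫ y in S, gibbsDensity ν ψ k y ∂ν) := by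
  have hc : 0 ≤ Real.exp ε - 1 := by linarith [Real.add_one_le_exp ε]
  have hp := (A.setIntegral_gibbsDensity_mem S k).1
  have e : ∀ y, Real.exp (inner ℝ k y + (ψ y + S.indicator (fun _ => ε) y)) =
      Real.exp (logPartition ν ψ k) * (gibbsDensity ν ψ k y +
        (Real.exp ε - 1) * S.indicator (gibbsDensity ν ψ k) y) := by
    intro y
    have e0 : Real.exp (inner ℝ k y + ψ y) =
        Real.exp (logPartition ν ψ k) * gibbsDensity ν ψ k y := by
      rw [gibbsDensity, ← Real.exp_add]; ring_nf
    rw [← add_assoc, Real.exp_add, e0]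
    by_cases hy : y ∈ S
    · simp only [hy, Set.indicator_of_mem]; ring
    · simp [hy]
  have hi := A.integrable_gibbsDensity k
  rw [logPartition]
  simp_rw [e]
  rw [integral_const_mul, integral_add hi ((hi.indicator hS).const_mul _), integral_const_mul,
    integral_indicator hS, A.integral_gibbsDensity,
    Real.log_mul (Real.exp_pos _).ne' (by positivity), Real.log_exp]

/-- Optimality of `ψ` in the dual problem, tested against the indicator of `S`. -/
lemma measureReal_le_of_isDualOptimal (A : Admissible ν ψ) [IsProbabilityMeasure ν]
    [IsProbabilityMeasure μ] {h : E d → E d} (hh : Measurable h)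
    (hL : Integrable (fun x => innerObjective ν ψ x (h x)) μ)
    (hopt : dualValue μ ν = ((∫ y, ψ y ∂ν + ∫ x, innerObjective ν ψ x (h x) ∂μ : ℝ) : EReal))
    {S : Set (E d)} (hS : MeasurableSet S) :
    ν.real S ≤ ∫ x, ∫ y in S, gibbsDensity ν ψ (h x) y ∂ν ∂μ := by
  set p : E d → ℝ := fun x => ∫ y in S, gibbsDensity ν ψ (h x) y ∂ν with hp
  have hp0 : ∀ x, 0 ≤ p x := fun x => (A.setIntegral_gibbsDensity_mem S (h x)).1
  have hp1 : ∀ x, p x ≤ 1 := fun x => (A.setIntegral_gibbsDensity_mem S (h x)).2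
  have hpm : Measurable p :=
    (StronglyMeasurable.integral_prod_right' (ν := ν.restrict S)
      (f := fun q : E d × E d => gibbsDensity ν ψ (h q.1) q.2)
      (A.measurable_gibbsDensity (hh.comp measurable_fst) measurable_snd).stronglyMeasurable).measurable
  have hpi : Integrable p μ := (integrable_const (1 : ℝ)).mono' hpm.aestronglyMeasurable
    (ae_of_all _ fun x => by rw [Real.norm_of_nonneg (hp0 x)]; exact hp1 x)
  have hM1 : ∫ x, p x ∂μ ≤ 1 := by
    simpa using integral_mono hpi (integrable_const (1 : ℝ)) hp1
  have hM0 : 0 ≤ ∫ x, p x ∂μ := integral_nonneg hp0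
  -- the perturbation `ψ + ε 1_S` costs at most `(exp ε - 1) p ≤ (ε + ε ^ 2) p` in the inner problem
  have key : ∀ ε : ℝ, 0 < ε → ε ≤ 1 → ν.real S ≤ (1 + ε) * ∫ x, p x ∂μ := by
    intro ε hε hε1
    have hc : 0 ≤ Real.exp ε - 1 := by linarith [Real.add_one_le_exp ε]
    have hq : ∀ x, Real.log (1 + (Real.exp ε - 1) * p x) ≤ (Real.exp ε - 1) * p x := fun x => by
      have := Real.log_le_sub_one_of_pos
        (show 0 < 1 + (Real.exp ε - 1) * p x by have := hp0 x; positivity)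
      linarith
    have hq0 : ∀ x, 0 ≤ Real.log (1 + (Real.exp ε - 1) * p x) := fun x => by
      have := mul_nonneg hc (hp0 x)
      exact Real.log_nonneg (by linarith)
    have hqi : Integrable (fun x => Real.log (1 + (Real.exp ε - 1) * p x)) μ :=
      (hpi.const_mul (Real.exp ε - 1)).mono' (Measurable.aestronglyMeasurable (by fun_prop))
        (ae_of_all _ fun x => by rw [Real.norm_of_nonneg (hq0 x)]; exact hq x)
    have e : ∀ x, innerObjective ν (fun y => ψ y + S.indicator (fun _ => ε) y) x (h x) =
        innerObjective ν ψ x (h x) - Real.log (1 + (Real.exp ε - 1) * p x) := fun x => by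
      rw [innerObjective, A.logPartition_add_indicator hS hε.le, innerObjective]; ring
    have h1 := (A.add_indicator hS hε.le).le_dualValue (μ := μ) hh (by
      simp_rw [e]; exact hL.sub hqi)
    simp_rw [e] at h1
    rw [hopt, EReal.coe_le_coe_iff, integral_sub hL hqi,
      integral_add A.integrable ((integrable_const ε).indicator hS), integral_indicator hS,
      setIntegral_const, smul_eq_mul] at h1
    have h2 : ∫ x, Real.log (1 + (Real.exp ε - 1) * p x) ∂μ ≤ (Real.exp ε - 1) * ∫ x, p x ∂μ := by
      rw [← integral_const_mul]
      exact integral_mono hqi (hpi.const_mul _) hq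
    have h3 : Real.exp ε - 1 ≤ ε + ε ^ 2 := by
      have := (abs_le.mp (Real.abs_exp_sub_one_sub_id_le (x := ε) (by rwa [abs_of_pos hε]))).2
      linarith
    have h4 := mul_le_mul_of_nonneg_right h3 hM0
    refine le_of_mul_le_mul_right ?_ hε
    nlinarith
  refine le_of_forall_pos_le_add fun ε hε => ?_
  have h1 := key (min ε 1) (lt_min hε one_pos) (min_le_right _ _)
  have h2 := mul_le_mul (min_le_left ε 1) hM1 hM0 hε.le
  linarith

section plan

variable {α : Type*} [MeasurableSpace α] {ρ : Measure α}

/-- Integrals against `plan` are iterated integrals against the Gibbs densities. -/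
lemma lintegral_plan (A : Admissible ν ψ) [SFinite ν] [SFinite ρ] {h : α → E d}
    (hh : Measurable h) {f : α × E d → ℝ≥0∞} (hf : Measurable f) :
    ∫⁻ p, f p ∂plan ρ ν ψ h =
      ∫⁻ x, ∫⁻ y, ENNReal.ofReal (gibbsDensity ν ψ (h x) y) * f (x, y) ∂ν ∂ρ := by
  have hm : Measurable fun p : α × E d => ENNReal.ofReal (gibbsDensity ν ψ (h p.1) p.2) :=
    (A.measurable_gibbsDensity (hh.comp measurable_fst) measurable_snd).ennreal_ofReal
  rw [plan, lintegral_withDensity_eq_lintegral_mul _ hm hf, lintegral_prod _ (hm.mul hf).aemeasurable]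
  rfl

lemma fst_plan (A : Admissible ν ψ) [NeZero ν] [SFinite ν] [SFinite ρ] {h : α → E d}
    (hh : Measurable h) : (plan ρ ν ψ h).fst = ρ := by
  ext S hS
  rw [Measure.fst_apply hS, ← lintegral_indicator_one (measurable_fst hS),
    A.lintegral_plan hh (measurable_one.indicator (measurable_fst hS)),
    ← lintegral_indicator_one hS]
  refine lintegral_congr fun x => ?_
  by_cases hx : x ∈ S
  · simp [Set.indicator, hx, A.lintegral_gibbsDensity]
  · simp [Set.indicator, hx]

lemma snd_plan_apply (A : Admissible ν ψ) [SFinite ν] [SFinite ρ] {h : α → E d}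
    (hh : Measurable h) {S : Set (E d)} (hS : MeasurableSet S) : (plan ρ ν ψ h).snd S =
      ∫⁻ x, ∫⁻ y in S, ENNReal.ofReal (gibbsDensity ν ψ (h x) y) ∂ν ∂ρ := by
  rw [Measure.snd_apply hS, ← lintegral_indicator_one (measurable_snd hS),
    A.lintegral_plan hh (measurable_one.indicator (measurable_snd hS))]
  refine lintegral_congr fun x => ?_
  rw [← lintegral_indicator hS]
  refine lintegral_congr fun y => ?_
  by_cases hy : y ∈ S <;> simp [Set.indicator, hy]

lemma isProbabilityMeasure_plan (A : Admissible ν ψ) [NeZero ν] [SFinite ν]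
    [IsProbabilityMeasure ρ] {h : α → E d} (hh : Measurable h) :
    IsProbabilityMeasure (plan ρ ν ψ h) := by
  constructor
  rw [← Measure.fst_univ, A.fst_plan hh, measure_univ]

end plan

/-- The first-order condition of the dual problem: the second marginal of the Gibbs plan is `ν`. -/
theorem snd_plan (A : Admissible ν ψ) [IsProbabilityMeasure ν]
    [IsProbabilityMeasure μ] {h : E d → E d} (hh : Measurable h)
    (hL : Integrable (fun x => innerObjective ν ψ x (h x)) μ)
    (hopt : dualValue μ ν = ((∫ y, ψ y ∂ν + ∫ x, innerObjective ν ψ x (h x) ∂μ : ℝ) : EReal)) :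
    (plan μ ν ψ h).snd = ν := by
  have := A.isProbabilityMeasure_plan (ρ := μ) hh
  refine (Measure.eq_of_le_of_isProbabilityMeasure (Measure.le_iff.mpr fun S hS => ?_)).symm
  rw [A.snd_plan_apply hh hS]
  have e : ∀ x, ∫⁻ y in S, ENNReal.ofReal (gibbsDensity ν ψ (h x) y) ∂ν =
      ENNReal.ofReal (∫ y in S, gibbsDensity ν ψ (h x) y ∂ν) := fun x =>
    (ofReal_integral_eq_lintegral_ofReal (A.integrable_gibbsDensity _).integrableOn
      (ae_of_all _ (gibbsDensity_nonneg _))).symm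
  simp_rw [e]
  rw [← ofReal_integral_eq_lintegral_ofReal]
  · rw [← ofReal_measureReal]
    exact ENNReal.ofReal_le_ofReal (A.measureReal_le_of_isDualOptimal hh hL hopt hS)
  · refine (integrable_const (1 : ℝ)).mono' ?_ (ae_of_all _ fun x => ?_)
    · exact (StronglyMeasurable.integral_prod_right' (ν := ν.restrict S)
        (f := fun q : E d × E d => gibbsDensity ν ψ (h q.1) q.2)
        (A.measurable_gibbsDensity (hh.comp measurable_fst)
          measurable_snd).stronglyMeasurable).aestronglyMeasurable
    · rw [Real.norm_of_nonneg (A.setIntegral_gibbsDensity_mem S (h x)).1]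
      exact (A.setIntegral_gibbsDensity_mem S (h x)).2
  · exact ae_of_all _ fun x => (A.setIntegral_gibbsDensity_mem S (h x)).1

end Admissible

/-! ### Relative entropy -/

/-- The easy half of the Donsker–Varadhan formula: any `g` with `∫ exp g dQ ≤ 1` gives a lower bound
for the relative entropy. -/
lemma coe_integral_le_klDiv {α : Type*} [MeasurableSpace α] {P Q : Measure α}
    [IsProbabilityMeasure P] [IsProbabilityMeasure Q] {g : α → ℝ} (hg : Integrable g P)
    (hexp : Integrable (fun x => Real.exp (g x)) Q) (hle : ∫ x, Real.exp (g x) ∂Q ≤ 1) :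
    ((∫ x, g x ∂P : ℝ) : EReal) ≤ (InformationTheory.klDiv P Q : EReal) := by
  by_cases htop : InformationTheory.klDiv P Q = ⊤
  · rw [htop]; exact le_top
  obtain ⟨hac, hint⟩ := InformationTheory.klDiv_ne_top_iff.mp htop
  rw [← EReal.coe_ennreal_toReal htop, InformationTheory.toReal_klDiv_eq_integral_klFun hac,
    EReal.coe_le_coe_iff, ← integral_rnDeriv_smul hac]
  have hg' := (integrable_rnDeriv_smul_iff hac).mpr hg
  have hkl := (InformationTheory.integrable_klFun_rnDeriv_iff hac).mpr hint
  -- Young's inequality `r g ≤ klFun r + exp g - 1`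
  have hY : ∀ x, (P.rnDeriv Q x).toReal • g x ≤
      InformationTheory.klFun (P.rnDeriv Q x).toReal + (Real.exp (g x) - 1) := by
    intro x
    rw [smul_eq_mul, InformationTheory.klFun_apply]
    rcases (ENNReal.toReal_nonneg (a := P.rnDeriv Q x)).eq_or_lt with h | h
    · rw [← h]; have := Real.exp_pos (g x); simp only [zero_mul]; linarith
    · set r := (P.rnDeriv Q x).toReal
      have h1 := Real.add_one_le_exp (g x - Real.log r)
      rw [Real.exp_sub, Real.exp_log h, le_div_iff₀ h] at h1
      linarith
  have hi : Integrable (fun x => Real.exp (g x) - 1) Q := hexp.sub (integrable_const 1)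
  have h1 := integral_mono hg' (hkl.add hi) hY
  simp only [Pi.add_apply] at h1
  rw [integral_add hkl hi, integral_sub hexp (integrable_const 1)] at h1
  simp only [integral_const, probReal_univ, smul_eq_mul, mul_one] at h1 ⊢
  linarith

namespace Admissible

section plan

variable {α β : Type*} [MeasurableSpace α] [MeasurableSpace β] {ρ : Measure α}

lemma measurable_plan_density (A : Admissible ν ψ) [SFinite ν] {h : α → E d} (hh : Measurable h) :
    Measurable fun p : α × E d => gibbsDensity ν ψ (h p.1) p.2 :=
  A.measurable_gibbsDensity (hh.comp measurable_fst) measurable_snd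

lemma integrable_plan_iff (A : Admissible ν ψ) [SFinite ν] {h : α → E d} (hh : Measurable h)
    {F : Type*} [NormedAddCommGroup F] [NormedSpace ℝ F] {f : α × E d → F} :
    Integrable f (plan ρ ν ψ h) ↔
      Integrable (fun p => gibbsDensity ν ψ (h p.1) p.2 • f p) (ρ.prod ν) := by
  rw [plan, integrable_withDensity_iff_integrable_smul'
    (A.measurable_plan_density hh).ennreal_ofReal (by simp)]
  simp [ENNReal.toReal_ofReal (gibbsDensity_nonneg _ _)]

lemma integral_plan (A : Admissible ν ψ) [SFinite ν] [SFinite ρ] {h : α → E d} (hh : Measurable h)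
    {F : Type*} [NormedAddCommGroup F] [NormedSpace ℝ F] {f : α × E d → F}
    (hf : Integrable f (plan ρ ν ψ h)) :
    ∫ p, f p ∂plan ρ ν ψ h = ∫ x, ∫ y, gibbsDensity ν ψ (h x) y • f (x, y) ∂ν ∂ρ := by
  rw [plan, integral_withDensity_eq_integral_toReal_smul
    (A.measurable_plan_density hh).ennreal_ofReal (by simp)]
  simp only [ENNReal.toReal_ofReal (gibbsDensity_nonneg _ _)]
  exact integral_prod _ ((A.integrable_plan_iff hh).mp hf)

lemma map_plan (A : Admissible ν ψ) [SFinite ν] [SFinite ρ] {T : α → β} (hT : Measurable T)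
    {h : β → E d} (hh : Measurable h) :
    (plan ρ ν ψ (h ∘ T)).map (Prod.map T id) = plan (ρ.map T) ν ψ h := by
  ext S hS
  have hTi : Measurable (Prod.map T (id : E d → E d)) := hT.prodMap measurable_id
  have hi : Measurable (S.indicator (1 : β × E d → ℝ≥0∞)) := measurable_one.indicator hS
  rw [← lintegral_indicator_one hS, ← lintegral_indicator_one hS, lintegral_map hi hTi]
  refine (A.lintegral_plan (ρ := ρ) (hh.comp hT) (hi.comp hTi)).trans ?_
  rw [A.lintegral_plan hh hi, lintegral_map _ hT]
  · rfl
  · exact ((A.measurable_plan_density hh).ennreal_ofReal.mul hi).lintegral_prod_right'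

lemma klDiv_plan (A : Admissible ν ψ) [IsProbabilityMeasure ν] [IsProbabilityMeasure ρ]
    {h : α → E d} (hh : Measurable h) :
    InformationTheory.klDiv (plan ρ ν ψ h) (ρ.prod ν) =
      ∫⁻ x, ∫⁻ y, ENNReal.ofReal (InformationTheory.klFun (gibbsDensity ν ψ (h x) y)) ∂ν ∂ρ := by
  have := A.isProbabilityMeasure_plan (ρ := ρ) hh
  have hm := A.measurable_plan_density hh
  have hac : plan ρ ν ψ h ≪ ρ.prod ν := withDensity_absolutelyContinuous _ _
  rw [InformationTheory.klDiv_eq_lintegral_klFun_of_ac hac,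
    ← lintegral_prod (fun p : α × E d =>
      ENNReal.ofReal (InformationTheory.klFun (gibbsDensity ν ψ (h p.1) p.2)))
    (InformationTheory.measurable_klFun.comp hm).ennreal_ofReal.aemeasurable]
  refine lintegral_congr_ae ?_
  filter_upwards [Measure.rnDeriv_withDensity (ρ.prod ν) hm.ennreal_ofReal] with p hp
  rw [plan, hp, ENNReal.toReal_ofReal (gibbsDensity_nonneg _ _)]

lemma klDiv_plan_comp (A : Admissible ν ψ) [IsProbabilityMeasure ν] [IsProbabilityMeasure ρ]
    {T : α → β} (hT : Measurable T) {h : β → E d} (hh : Measurable h) :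
    InformationTheory.klDiv (plan ρ ν ψ (h ∘ T)) (ρ.prod ν) =
      InformationTheory.klDiv (plan (ρ.map T) ν ψ h) ((ρ.map T).prod ν) := by
  have := Measure.isProbabilityMeasure_map (μ := ρ) hT.aemeasurable
  rw [A.klDiv_plan (hh.comp hT), A.klDiv_plan hh, lintegral_map _ hT]
  · rfl
  · exact (InformationTheory.measurable_klFun.comp
      (A.measurable_plan_density hh)).ennreal_ofReal.lintegral_prod_right'

end plan

lemma integrable_gibbsDensity_mul_potential (A : Admissible ν ψ) [NeZero ν] (k : E d) :
    Integrable (fun y => gibbsDensity ν ψ k y * ψ y) ν := by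
  obtain ⟨a, b, ha, hb, hab⟩ := A.growth
  refine A.integrable_gibbsDensity_smul k A.measurable.aestronglyMeasurable zero_le_one
    (C := a + b) fun y => (hab y).trans ?_
  have h1 : ‖y‖ ≤ Real.exp ‖y‖ := by linarith [Real.add_one_le_exp ‖y‖]
  have h2 : 1 ≤ Real.exp ‖y‖ := Real.one_le_exp (norm_nonneg y)
  rw [one_mul]
  nlinarith

/-- The relative entropy of the Gibbs plan is the value of the dual functional. -/
lemma klDiv_plan_eq (A : Admissible ν ψ) [IsProbabilityMeasure ν] [IsProbabilityMeasure μ]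
    {h : E d → E d} (hh : Measurable h) (hmean : ∀ᵐ x ∂μ, gibbsMean ν ψ (h x) = x)
    (hsnd : (plan μ ν ψ h).snd = ν)
    (hL : Integrable (fun x => innerObjective ν ψ x (h x)) μ) :
    (InformationTheory.klDiv (plan μ ν ψ h) (μ.prod ν) : EReal) =
      ((∫ y, ψ y ∂ν + ∫ x, innerObjective ν ψ x (h x) ∂μ : ℝ) : EReal) := by
  -- the entropy of a single Gibbs measure
  have hone : ∀ k, Integrable (fun y => InformationTheory.klFun (gibbsDensity ν ψ k y)) ν ∧
      ∫ y, InformationTheory.klFun (gibbsDensity ν ψ k y) ∂ν =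
        ∫ y, gibbsDensity ν ψ k y * ψ y ∂ν + innerObjective ν ψ (gibbsMean ν ψ k) k := by
    intro k
    have i1 := A.integrable_gibbsDensity_mul_inner k k
    have i2 := A.integrable_gibbsDensity_mul_potential k
    have i3 := A.integrable_gibbsDensity k
    have e : ∀ y, InformationTheory.klFun (gibbsDensity ν ψ k y) =
        gibbsDensity ν ψ k y * inner ℝ k y + gibbsDensity ν ψ k y * ψ y
          + (1 - (logPartition ν ψ k + 1) * gibbsDensity ν ψ k y) := by
      intro y
      rw [InformationTheory.klFun_apply]
      nth_rw 2 [gibbsDensity]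
      rw [Real.log_exp]
      ring
    simp_rw [e]
    have i4 : Integrable (fun y => gibbsDensity ν ψ k y * inner ℝ k y +
        gibbsDensity ν ψ k y * ψ y) ν := i1.add i2
    have i5 : Integrable (fun y => 1 - (logPartition ν ψ k + 1) * gibbsDensity ν ψ k y) ν :=
      (integrable_const _).sub (i3.const_mul _)
    refine ⟨i4.add i5, ?_⟩
    rw [integral_add i4 i5, integral_add i1 i2, integral_sub (integrable_const _) (i3.const_mul _),
      integral_const_mul, A.integral_gibbsDensity, A.integral_gibbsDensity_mul_inner]
    simp only [integral_const, probReal_univ, smul_eq_mul, innerObjective]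
    ring
  have hnn : ∀ k y, 0 ≤ InformationTheory.klFun (gibbsDensity ν ψ k y) := fun k y =>
    InformationTheory.klFun_nonneg (gibbsDensity_nonneg k y)
  have hψi : Integrable (fun p : E d × E d => ψ p.2) (plan μ ν ψ h) := by
    have : Integrable ψ (plan μ ν ψ h).snd := hsnd.symm ▸ A.integrable
    exact this.comp_measurable measurable_snd
  have hψ : ∫ x, ∫ y, gibbsDensity ν ψ (h x) y * ψ y ∂ν ∂μ = ∫ y, ψ y ∂ν := by
    rw [← hsnd, Measure.snd, integral_map measurable_snd.aemeasurable
      A.measurable.aestronglyMeasurable, A.integral_plan hh hψi]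
    rw [show Measure.map Prod.snd (plan μ ν ψ h) = ν from hsnd]
    rfl
  have hψ' : Integrable (fun x => ∫ y, gibbsDensity ν ψ (h x) y * ψ y ∂ν) μ :=
    ((A.integrable_plan_iff hh).mp hψi).integral_prod_left
  have e2 : (fun x => ∫ y, InformationTheory.klFun (gibbsDensity ν ψ (h x) y) ∂ν) =ᵐ[μ]
      fun x => ∫ y, gibbsDensity ν ψ (h x) y * ψ y ∂ν + innerObjective ν ψ x (h x) :=
    hmean.mono fun x hx => by simp only [(hone (h x)).2, hx]
  have e3 : ∀ x, ∫⁻ y, ENNReal.ofReal (InformationTheory.klFun (gibbsDensity ν ψ (h x) y)) ∂ν =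
      ENNReal.ofReal (∫ y, InformationTheory.klFun (gibbsDensity ν ψ (h x) y) ∂ν) := fun x =>
    (ofReal_integral_eq_lintegral_ofReal (hone (h x)).1 (ae_of_all _ (hnn (h x)))).symm
  have hq0 : ∀ x, 0 ≤ ∫ y, InformationTheory.klFun (gibbsDensity ν ψ (h x) y) ∂ν := fun x =>
    integral_nonneg (hnn (h x))
  rw [A.klDiv_plan hh]
  simp_rw [e3]
  rw [← ofReal_integral_eq_lintegral_ofReal ((integrable_congr e2).mpr (hψ'.add hL))
    (ae_of_all _ hq0), EReal.coe_ennreal_ofReal, max_eq_left (integral_nonneg hq0),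
    integral_congr_ae e2, integral_add hψ' hL, hψ]

end Admissible

/-! ### The martingale Schrödinger problem -/

lemma integrable_inner_of_memLp_two {α : Type*} [MeasurableSpace α] {P : Measure α}
    {f g : α → E d} (hf : MemLp f 2 P) (hg : MemLp g 2 P) :
    Integrable (fun x => (inner ℝ (f x) (g x) : ℝ)) P := by
  have h1 := (memLp_two_iff_integrable_sq_norm hf.1).mp hf
  have h2 := (memLp_two_iff_integrable_sq_norm hg.1).mp hg
  refine (h1.add h2).mono' (hf.1.inner hg.1) (ae_of_all _ fun x => ?_)
  have := norm_inner_le_norm (𝕜 := ℝ) (f x) (g x)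
  simp only [Pi.add_apply]
  nlinarith [sq_nonneg (‖f x‖ - ‖g x‖), sq_nonneg (‖f x‖), sq_nonneg (‖g x‖)]

lemma integrable_snd_of_mem_Cpl {η : Measure (E d)} {π : Measure (E d × E d)} (hπ : π ∈ Cpl η ν)
    {F : Type*} [NormedAddCommGroup F] {f : E d → F} (hf : Integrable f ν) :
    Integrable (fun p => f p.2) π := by
  have : Integrable f π.snd := hπ.2.symm ▸ hf
  exact this.comp_measurable measurable_snd

lemma integrable_fst_of_mem_Cpl {η : Measure (E d)} {π : Measure (E d × E d)} (hπ : π ∈ Cpl η ν)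
    {F : Type*} [NormedAddCommGroup F] {f : E d → F} (hf : Integrable f η) :
    Integrable (fun p => f p.1) π := by
  have : Integrable f π.fst := hπ.1.symm ▸ hf
  exact this.comp_measurable measurable_fst

lemma integral_snd_of_mem_Cpl {η : Measure (E d)} {π : Measure (E d × E d)} (hπ : π ∈ Cpl η ν)
    {f : E d → ℝ} (hf : Integrable f ν) : ∫ p, f p.2 ∂π = ∫ y, f y ∂ν := by
  have h := hπ.2
  rw [Measure.snd] at h
  rw [← h, integral_map measurable_snd.aemeasurable (h.symm ▸ hf.1)]

lemma integral_fst_of_mem_Cpl {η : Measure (E d)} {π : Measure (E d × E d)} (hπ : π ∈ Cpl η ν)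
    {f : E d → ℝ} (hf : Integrable f η) : ∫ p, f p.1 ∂π = ∫ x, f x ∂η := by
  have h := hπ.1
  rw [Measure.fst] at h
  rw [← h, integral_map measurable_fst.aemeasurable (h.symm ▸ hf.1)]

lemma isProbabilityMeasure_of_mem_Cpl {η : Measure (E d)} [IsProbabilityMeasure η]
    {π : Measure (E d × E d)} (hπ : π ∈ Cpl η ν) : IsProbabilityMeasure π := by
  constructor
  rw [← Measure.fst_univ, hπ.1, measure_univ]

/-- The martingale property, tested against a bounded function of the first variable. -/
lemma integral_inner_of_mem_MT [IsProbabilityMeasure μ] (hμ1 : Integrable (fun x => x) μ)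
    {m : Measure (E d × E d)} (hm : m ∈ MT μ ν) {w : E d → E d} (hw : Measurable w) {c : ℝ}
    (hwc : ∀ x, ‖w x‖ ≤ c) :
    Integrable (fun p : E d × E d => (inner ℝ (w p.1) p.2 : ℝ)) m ∧
    ∫ p, inner ℝ (w p.1) p.2 ∂m = ∫ x, inner ℝ (w x) x ∂μ := by
  obtain ⟨hc, hi, hce⟩ := hm
  have := isProbabilityMeasure_of_mem_Cpl hc
  have hle : MeasurableSpace.comap (Prod.fst : E d × E d → E d) inferInstance ≤
      Prod.instMeasurableSpace :=
    measurable_fst.comap_le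
  have hb : ∀ {f : E d × E d → E d}, Integrable f m →
      Integrable (fun p => (inner ℝ (w p.1) (f p) : ℝ)) m := fun {f} hf => by
    refine (hf.norm.const_mul c).mono' ((hw.comp measurable_fst).aestronglyMeasurable.inner hf.1)
      (ae_of_all _ fun p => (norm_inner_le_norm _ _).trans ?_)
    exact mul_le_mul_of_nonneg_right (hwc _) (norm_nonneg _)
  refine ⟨hb hi, ?_⟩
  have hsm : StronglyMeasurable[MeasurableSpace.comap (Prod.fst : E d × E d → E d) inferInstance]
      fun p : E d × E d => w p.1 :=
    (hw.comp (comap_measurable Prod.fst)).stronglyMeasurable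
  have h1 : condExp (MeasurableSpace.comap (Prod.fst : E d × E d → E d) inferInstance) m
      (fun p => (inner ℝ (w p.1) p.2 : ℝ)) =ᵐ[m] fun p => inner ℝ (w p.1)
        (condExp (MeasurableSpace.comap (Prod.fst : E d × E d → E d) inferInstance) m
          (fun p => p.2) p) :=
    condExp_bilin_of_stronglyMeasurable_left (innerSL ℝ) hsm (hb hi) hi
  have hμi : Integrable (fun x => (inner ℝ (w x) x : ℝ)) μ := by
    refine (hμ1.norm.const_mul c).mono' (hw.aestronglyMeasurable.inner hμ1.1)
      (ae_of_all _ fun x => (norm_inner_le_norm _ _).trans ?_)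
    exact mul_le_mul_of_nonneg_right (hwc _) (norm_nonneg _)
  rw [← integral_condExp hle, integral_congr_ae h1, ← integral_fst_of_mem_Cpl hc hμi]
  refine integral_congr_ae ?_
  filter_upwards [hce] with p hp
  rw [hp]

namespace Admissible

/-- The Gibbs plan is a martingale coupling. -/
lemma plan_mem_MT (A : Admissible ν ψ) [IsProbabilityMeasure ν] [IsProbabilityMeasure μ]
    (hμ1 : Integrable (fun x => x) μ) (hν1 : Integrable (fun y => y) ν)
    {h : E d → E d} (hh : Measurable h) (hmean : ∀ᵐ x ∂μ, gibbsMean ν ψ (h x) = x)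
    (hsnd : (plan μ ν ψ h).snd = ν) : plan μ ν ψ h ∈ MT μ ν := by
  have hc : plan μ ν ψ h ∈ Cpl μ ν := ⟨A.fst_plan hh, hsnd⟩
  have := A.isProbabilityMeasure_plan (ρ := μ) hh
  have i1 : Integrable (fun p : E d × E d => p.1) (plan μ ν ψ h) :=
    integrable_fst_of_mem_Cpl (f := fun x => x) hc hμ1
  have i2 : Integrable (fun p : E d × E d => p.2) (plan μ ν ψ h) :=
    integrable_snd_of_mem_Cpl (f := fun y => y) hc hν1
  have hle : MeasurableSpace.comap (Prod.fst : E d × E d → E d) inferInstance ≤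
      Prod.instMeasurableSpace :=
    measurable_fst.comap_le
  have hset : ∀ S : Set (E d), MeasurableSet S → ∫ p in Prod.fst ⁻¹' S, p.1 ∂plan μ ν ψ h =
      ∫ p in Prod.fst ⁻¹' S, p.2 ∂plan μ ν ψ h := by
    intro S hS
    have hS' : MeasurableSet (Prod.fst ⁻¹' S : Set (E d × E d)) := measurable_fst hS
    rw [← integral_indicator hS', ← integral_indicator hS',
      A.integral_plan hh (i1.indicator hS'), A.integral_plan hh (i2.indicator hS')]
    refine integral_congr_ae (hmean.mono fun x hx => ?_)
    by_cases hxS : x ∈ S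
    · simp only [Set.indicator, Set.mem_preimage, hxS, if_true]
      rw [integral_smul_const, A.integral_gibbsDensity, one_smul]
      exact hx.symm
    · simp [Set.indicator, hxS]
  have hsm : AEStronglyMeasurable[MeasurableSpace.comap (Prod.fst : E d × E d → E d) inferInstance]
      (fun p : E d × E d => p.1) (plan μ ν ψ h) :=
    (comap_measurable Prod.fst).stronglyMeasurable.aestronglyMeasurable
  refine ⟨hc, i2, Filter.EventuallyEq.symm ?_⟩
  refine ae_eq_condExp_of_forall_setIntegral_eq hle i2 (fun s _ _ => i1.integrableOn) ?_ hsm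
  rintro _ ⟨S, hS, rfl⟩ -
  exact hset S hS

/-- The dual value is a lower bound for the entropy of every martingale coupling. Since
`h(x) · y` need not be integrable, the Donsker–Varadhan bound is applied to the logarithm of the
Gibbs density on the event that `h` and `log Z(h)` are at most `n`, and then `n → ∞`. -/
lemma le_klDiv_of_mem_MT (A : Admissible ν ψ) [IsProbabilityMeasure ν] [IsProbabilityMeasure μ]
    (hμ1 : Integrable (fun x => x) μ) {h : E d → E d} (hh : Measurable h)
    (hL : Integrable (fun x => innerObjective ν ψ x (h x)) μ)
    {m : Measure (E d × E d)} (hm : m ∈ MT μ ν) :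
    ((∫ y, ψ y ∂ν + ∫ x, innerObjective ν ψ x (h x) ∂μ : ℝ) : EReal) ≤
      (InformationTheory.klDiv m (μ.prod ν) : EReal) := by
  have hc := hm.1
  have := isProbabilityMeasure_of_mem_Cpl hc
  have hΛ := A.measurable_logPartition.comp hh
  let S : ℕ → Set (E d) := fun n => {x | ‖h x‖ ≤ n ∧ |logPartition ν ψ (h x)| ≤ n}
  have hS : ∀ n, MeasurableSet (S n) := fun n =>
    (measurableSet_le hh.norm measurable_const).inter
      (measurableSet_le (measurable_norm.comp hΛ) measurable_const)
  have hev : ∀ x, ∀ᶠ n : ℕ in Filter.atTop, x ∈ S n := fun x => by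
    filter_upwards [Filter.eventually_ge_atTop ⌈max ‖h x‖ |logPartition ν ψ (h x)|⌉₊] with n hn
    have := Nat.ceil_le.mp hn
    exact ⟨(le_max_left _ _).trans this, (le_max_right _ _).trans this⟩
  have hψi : Integrable (fun p : E d × E d => ψ p.2) m := integrable_snd_of_mem_Cpl hc A.integrable
  have hstep : ∀ n, ((∫ p, (Prod.fst ⁻¹' S n).indicator (fun p : E d × E d => ψ p.2) p ∂m +
      ∫ x, (S n).indicator (fun x => innerObjective ν ψ x (h x)) x ∂μ : ℝ) : EReal) ≤
      (InformationTheory.klDiv m (μ.prod ν) : EReal) := by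
    intro n
    let w : E d → E d := (S n).indicator h
    let l : E d → ℝ := (S n).indicator fun x => logPartition ν ψ (h x)
    have hw : Measurable w := hh.indicator (hS n)
    have hwn : ∀ x, ‖w x‖ ≤ n := fun x => by
      by_cases hx : x ∈ S n
      · simpa [w, hx] using hx.1
      · simp [w, hx]
    have hl : Integrable l μ := by
      refine (integrable_const (n : ℝ)).mono' (hΛ.indicator (hS n)).aestronglyMeasurable
        (ae_of_all _ fun x => ?_)
      by_cases hx : x ∈ S n
      · simpa [l, hx] using hx.2
      · simp [l, hx]
    obtain ⟨iw, ew⟩ := integral_inner_of_mem_MT hμ1 hm hw hwn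
    have il : Integrable (fun p : E d × E d => l p.1) m := integrable_fst_of_mem_Cpl hc hl
    have iψ : Integrable ((Prod.fst ⁻¹' S n).indicator (fun p : E d × E d => ψ p.2)) m :=
      hψi.indicator (measurable_fst (hS n))
    let g : E d × E d → ℝ := fun p =>
      (Prod.fst ⁻¹' S n).indicator (fun p : E d × E d => ψ p.2) p + (inner ℝ (w p.1) p.2 - l p.1)
    have ig : Integrable g m := iψ.add (iw.sub il)
    have hgin : ∀ x ∈ S n, ∀ y, Real.exp (g (x, y)) = gibbsDensity ν ψ (h x) y := by
      intro x hx y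
      simp only [g, w, l, Set.indicator, Set.mem_preimage, hx, if_true, gibbsDensity]
      ring_nf
    have hgout : ∀ x ∉ S n, ∀ y, Real.exp (g (x, y)) = 1 := by
      intro x hx y
      simp [g, w, l, Set.indicator, hx]
    have hgm : Measurable g := by
      have h1 : Measurable ((Prod.fst ⁻¹' S n).indicator (fun p : E d × E d => ψ p.2)) :=
        (A.measurable.comp measurable_snd).indicator (measurable_fst (hS n))
      have h2 : Measurable l := hΛ.indicator (hS n)
      fun_prop
    have hlint : ∫⁻ p, ENNReal.ofReal (Real.exp (g p)) ∂μ.prod ν = 1 := by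
      rw [lintegral_prod _ hgm.exp.ennreal_ofReal.aemeasurable]
      have : ∀ x, ∫⁻ y, ENNReal.ofReal (Real.exp (g (x, y))) ∂ν = 1 := fun x => by
        by_cases hx : x ∈ S n
        · simp_rw [hgin x hx, A.lintegral_gibbsDensity]
        · simp [hgout x hx]
      simp [this]
    have hnn : 0 ≤ᵐ[μ.prod ν] fun p => Real.exp (g p) := ae_of_all _ fun p => (Real.exp_pos _).le
    have iexp : Integrable (fun p => Real.exp (g p)) (μ.prod ν) :=
      (lintegral_ofReal_ne_top_iff_integrable hgm.exp.aestronglyMeasurable hnn).mp (by simp [hlint])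
    have hone : ∫ p, Real.exp (g p) ∂μ.prod ν ≤ 1 := by
      rw [integral_eq_lintegral_of_nonneg_ae hnn hgm.exp.aestronglyMeasurable, hlint]
      simp
    refine le_trans (le_of_eq ?_) (coe_integral_le_klDiv ig iexp hone)
    have iwl : Integrable (fun p : E d × E d => (inner ℝ (w p.1) p.2 : ℝ) - l p.1) m := iw.sub il
    rw [EReal.coe_eq_coe_iff, integral_add iψ iwl, integral_sub iw il, ew,
      integral_fst_of_mem_Cpl hc hl, ← integral_sub _ hl]
    · congr 2
      ext x
      by_cases hx : x ∈ S n <;> simp [w, l, hx, innerObjective]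
    · refine ((hL.indicator (hS n)).add hl).congr (ae_of_all _ fun x => ?_)
      by_cases hx : x ∈ S n <;> simp [w, l, hx, innerObjective]
  have hlim1 : Filter.Tendsto (fun n => ∫ p, (Prod.fst ⁻¹' S n).indicator
      (fun p : E d × E d => ψ p.2) p ∂m) Filter.atTop (nhds (∫ y, ψ y ∂ν)) := by
    rw [← integral_snd_of_mem_Cpl hc A.integrable]
    refine tendsto_integral_of_dominated_convergence (fun p => |ψ p.2|)
      (fun n => (hψi.indicator (measurable_fst (hS n))).1) hψi.abs
      (fun n => ae_of_all _ fun p => norm_indicator_le_norm_self _ _) (ae_of_all _ fun p => ?_)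
    refine tendsto_const_nhds.congr' ((hev p.1).mono fun n hn => ?_)
    simp [hn]
  have hlim2 : Filter.Tendsto (fun n => ∫ x, (S n).indicator
      (fun x => innerObjective ν ψ x (h x)) x ∂μ) Filter.atTop
      (nhds (∫ x, innerObjective ν ψ x (h x) ∂μ)) := by
    refine tendsto_integral_of_dominated_convergence (fun x => |innerObjective ν ψ x (h x)|)
      (fun n => (hL.indicator (hS n)).1) hL.abs
      (fun n => ae_of_all _ fun p => norm_indicator_le_norm_self _ _) (ae_of_all _ fun x => ?_)
    refine tendsto_const_nhds.congr' ((hev x).mono fun n hn => ?_)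
    simp [hn]
  exact le_of_tendsto ((continuous_coe_real_ereal.tendsto _).comp (hlim1.add hlim2))
    (Filter.Eventually.of_forall hstep)

end Admissible

/-! ### The variational problem -/

lemma map_prodMap_mem_Cpl {α : Type*} [MeasurableSpace α] {P : Measure (α × E d)} {T : α → E d}
    (hT : Measurable T) : P.map (Prod.map T id) ∈ Cpl (P.fst.map T) P.snd := by
  have hTi : Measurable (Prod.map T (id : E d → E d)) := hT.prodMap measurable_id
  constructor
  · rw [Measure.fst, Measure.fst, Measure.map_map measurable_fst hTi,
      Measure.map_map hT measurable_fst]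
    rfl
  · rw [Measure.snd, Measure.snd, Measure.map_map measurable_snd hTi]
    rfl

namespace Admissible

/-- The cross moment of the Gibbs plan only sees the means of the Gibbs measures. -/
lemma integral_inner_plan (A : Admissible ν ψ) [IsProbabilityMeasure ν]
    {α : Type*} [MeasurableSpace α] {ρ : Measure α} [IsProbabilityMeasure ρ]
    (hν2 : MemLp (fun y => y) 2 ν) {h f : α → E d} (hh : Measurable h) (hf : MemLp f 2 ρ)
    (hsnd : (plan ρ ν ψ h).snd = ν) :
    ∫ p, inner ℝ (f p.1) p.2 ∂plan ρ ν ψ h = ∫ x, inner ℝ (f x) (gibbsMean ν ψ (h x)) ∂ρ := by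
  have h1 : MemLp (fun p : α × E d => f p.1) 2 (plan ρ ν ψ h) :=
    hf.comp_measurePreserving ⟨measurable_fst, A.fst_plan hh⟩
  have h2 : MemLp (fun p : α × E d => p.2) 2 (plan ρ ν ψ h) :=
    hν2.comp_measurePreserving ⟨measurable_snd, hsnd⟩
  rw [A.integral_plan hh (integrable_inner_of_memLp_two h1 h2)]
  simp_rw [smul_eq_mul, A.integral_gibbsDensity_mul_inner]

/-- Weak duality. A coupling `κ` of `η` and `μ` is glued with the Gibbs plan along `μ`, with
conditional independence given the common variable. The resulting coupling of `η` and `ν` has at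
most the entropy of the Gibbs plan by the data processing inequality, and it has the cross moment
of `κ` by the martingale property. -/
lemma spValue_add_crossMoment_le (A : Admissible ν ψ) [IsProbabilityMeasure ν]
    [IsProbabilityMeasure μ] (hν2 : MemLp (fun y => y) 2 ν) {h : E d → E d} (hh : Measurable h)
    (hmean : ∀ᵐ x ∂μ, gibbsMean ν ψ (h x) = x) (hsnd : (plan μ ν ψ h).snd = ν)
    {η : Measure (E d)} (hη : η ∈ P2 d) {κ : Measure (E d × E d)} (hκ : κ ∈ Cpl η μ) :
    spValue η ν + (crossMoment κ : EReal) ≤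
      (InformationTheory.klDiv (plan μ ν ψ h) (μ.prod ν) : EReal) := by
  obtain ⟨hηp, hη2⟩ := hη
  have := isProbabilityMeasure_of_mem_Cpl hκ
  have hκ1 : κ.map Prod.fst = η := hκ.1
  have hκ2 : κ.map Prod.snd = μ := hκ.2
  have hhs : Measurable (h ∘ (Prod.snd : E d × E d → E d)) := hh.comp measurable_snd
  set Θ := plan κ ν ψ (h ∘ Prod.snd) with hΘ
  have hΘp : IsProbabilityMeasure Θ := A.isProbabilityMeasure_plan hhs
  have hΘ1 : Θ.fst = κ := A.fst_plan hhs
  have hΘ2 : Θ.snd = ν := by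
    have h1 := (map_prodMap_mem_Cpl (P := Θ) (T := Prod.snd) measurable_snd).2
    rw [hΘ, A.map_plan measurable_snd hh, hκ2, hsnd] at h1
    exact h1.symm
  have hTi : Measurable (Prod.map (Prod.fst : E d × E d → E d) (id : E d → E d)) :=
    measurable_fst.prodMap measurable_id
  have hπ : Θ.map (Prod.map Prod.fst id) ∈ Cpl η ν := by
    have h1 := map_prodMap_mem_Cpl (P := Θ) (T := Prod.fst) measurable_fst
    rwa [hΘ1, hκ1, hΘ2] at h1
  have hprod : η.prod ν = (κ.prod ν).map (Prod.map Prod.fst id) := by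
    rw [← Measure.map_prod_map κ ν measurable_fst measurable_id, hκ1, Measure.map_id]
  have hkl : InformationTheory.klDiv (Θ.map (Prod.map Prod.fst id)) (η.prod ν) ≤
      InformationTheory.klDiv (plan μ ν ψ h) (μ.prod ν) := by
    rw [hprod]
    refine (InformationTheory.klDiv_map_le _ _ hTi).trans_eq ?_
    rw [hΘ, A.klDiv_plan_comp measurable_snd hh, hκ2]
  have hcross : crossMoment (Θ.map (Prod.map Prod.fst id)) = crossMoment κ := by
    have hf : MemLp (fun q : E d × E d => q.1) 2 κ :=
      hη2.comp_measurePreserving ⟨measurable_fst, hκ1⟩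
    rw [crossMoment, integral_map hTi.aemeasurable
      (measurable_fst.inner measurable_snd).aestronglyMeasurable]
    refine (A.integral_inner_plan hν2 hhs hf hΘ2).trans (integral_congr_ae ?_)
    have hmean' : ∀ᵐ x ∂κ.map Prod.snd, gibbsMean ν ψ (h x) = x := hκ2.symm ▸ hmean
    filter_upwards [ae_of_ae_map measurable_snd.aemeasurable hmean'] with q hq
    simp only [Function.comp_apply, hq]
  have hle : spValue η ν ≤ (InformationTheory.klDiv (plan μ ν ψ h) (μ.prod ν) : EReal) -
      (crossMoment κ : EReal) := by
    refine (iInf₂_le _ hπ).trans ?_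
    rw [spObjective, hcross]
    exact EReal.sub_le_sub (EReal.coe_ennreal_le_coe_ennreal_iff.mpr hkl) le_rfl
  exact (EReal.le_sub_iff_add_le (Or.inl (EReal.coe_ne_bot _)) (Or.inl (EReal.coe_ne_top _))).mp hle

lemma vpObjective_le (A : Admissible ν ψ) [IsProbabilityMeasure ν]
    [IsProbabilityMeasure μ] (hν2 : MemLp (fun y => y) 2 ν) {h : E d → E d} (hh : Measurable h)
    (hmean : ∀ᵐ x ∂μ, gibbsMean ν ψ (h x) = x) (hsnd : (plan μ ν ψ h).snd = ν)
    (hL : Integrable (fun x => innerObjective ν ψ x (h x)) μ)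
    {η : Measure (E d)} (hη : η ∈ P2 d) :
    vpObjective μ ν η ≤
      ((∫ y, ψ y ∂ν + ∫ x, innerObjective ν ψ x (h x) ∂μ : ℝ) : EReal) := by
  have hηp := hη.1
  have hκ : ∀ κ ∈ Cpl η μ, spValue η ν + (crossMoment κ : EReal) ≤
      ((∫ y, ψ y ∂ν + ∫ x, innerObjective ν ψ x (h x) ∂μ : ℝ) : EReal) := fun κ hκ =>
    (A.spValue_add_crossMoment_le hν2 hh hmean hsnd hη hκ).trans_eq
      (A.klDiv_plan_eq hh hmean hsnd hL)
  have hprod : η.prod μ ∈ Cpl η μ := ⟨Measure.fst_prod, Measure.snd_prod⟩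
  rw [vpObjective, MCov]
  induction hs : spValue η ν using EReal.rec with
  | bot => simp
  | top =>
    have := hκ _ hprod
    rw [hs, EReal.top_add_coe, top_le_iff] at this
    exact absurd this (EReal.coe_ne_top _)
  | coe s =>
    rw [add_comm]
    refine (EReal.le_sub_iff_add_le (Or.inl (EReal.coe_ne_bot _))
      (Or.inl (EReal.coe_ne_top _))).mp (iSup₂_le fun κ hκ' => ?_)
    refine (EReal.le_sub_iff_add_le (Or.inl (EReal.coe_ne_bot _))
      (Or.inl (EReal.coe_ne_top _))).mpr ?_
    rw [add_comm, ← hs]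
    exact hκ κ hκ'

/-- The Schrödinger problem between the law of `h` and `ν`: the coupling built from the potentials
attains the Donsker–Varadhan lower bound given by the logarithm of its density. -/
lemma spObjective_bounds (A : Admissible ν ψ) [IsProbabilityMeasure ν]
    [IsProbabilityMeasure μ] (hμ2 : MemLp (fun x => x) 2 μ) (hν2 : MemLp (fun y => y) 2 ν)
    {h : E d → E d} (hh : Measurable h) (hh2 : MemLp h 2 μ)
    (hmean : ∀ᵐ x ∂μ, gibbsMean ν ψ (h x) = x) (hsnd : (plan μ ν ψ h).snd = ν)
    (hL : Integrable (fun x => innerObjective ν ψ x (h x)) μ) :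
    spObjective (μ.map h) ν (plan (μ.map h) ν ψ id) =
      ((∫ y, ψ y ∂ν + ∫ x, innerObjective ν ψ x (h x) ∂μ - ∫ x, inner ℝ (h x) x ∂μ : ℝ) : EReal) ∧
    ∀ π ∈ Cpl (μ.map h) ν,
      ((∫ y, ψ y ∂ν + ∫ x, innerObjective ν ψ x (h x) ∂μ - ∫ x, inner ℝ (h x) x ∂μ : ℝ) : EReal) ≤
        spObjective (μ.map h) ν π := by
  have := Measure.isProbabilityMeasure_map (μ := μ) hh.aemeasurable
  constructor
  · have hkl : (InformationTheory.klDiv (plan (μ.map h) ν ψ id) ((μ.map h).prod ν) : EReal) =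
        ((∫ y, ψ y ∂ν + ∫ x, innerObjective ν ψ x (h x) ∂μ : ℝ) : EReal) := by
      rw [← A.klDiv_plan_comp hh measurable_id]
      exact A.klDiv_plan_eq hh hmean hsnd hL
    have hcross : crossMoment (plan (μ.map h) ν ψ id) = ∫ x, inner ℝ (h x) x ∂μ := by
      rw [← A.map_plan hh measurable_id, crossMoment,
        integral_map (hh.prodMap measurable_id).aemeasurable
          (measurable_fst.inner measurable_snd).aestronglyMeasurable]
      refine (A.integral_inner_plan hν2 hh hh2 hsnd).trans (integral_congr_ae ?_)
      exact hmean.mono fun x hx => by simp only [hx]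
    rw [spObjective, hkl, hcross, EReal.coe_sub]
  · intro π hπ
    have := isProbabilityMeasure_of_mem_Cpl hπ
    have hC : Integrable (fun x => (inner ℝ (h x) x : ℝ)) μ := integrable_inner_of_memLp_two hh2 hμ2
    have hl : Integrable (fun x => logPartition ν ψ (h x)) μ :=
      (hC.sub hL).congr (ae_of_all _ fun x => by simp [innerObjective])
    have hl' : Integrable (logPartition ν ψ) (μ.map h) :=
      (integrable_map_measure A.measurable_logPartition.aestronglyMeasurable hh.aemeasurable).mpr hl
    have hcr : Integrable (fun p : E d × E d => (inner ℝ p.1 p.2 : ℝ)) π := by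
      refine integrable_inner_of_memLp_two (f := fun p : E d × E d => p.1)
        (g := fun p : E d × E d => p.2) ?_
        (hν2.comp_measurePreserving ⟨measurable_snd, hπ.2⟩)
      have h1 : MemLp (fun x => x) 2 (μ.map h) :=
        (memLp_map_measure_iff (by fun_prop) hh.aemeasurable).mpr hh2
      exact h1.comp_measurePreserving ⟨measurable_fst, hπ.1⟩
    have iψ := integrable_snd_of_mem_Cpl hπ A.integrable
    have il := integrable_fst_of_mem_Cpl hπ hl'
    have i1 : Integrable (fun p : E d × E d => inner ℝ p.1 p.2 + ψ p.2) π := hcr.add iψ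
    have ig : Integrable (fun p : E d × E d =>
      inner ℝ p.1 p.2 + ψ p.2 - logPartition ν ψ p.1) π := i1.sub il
    have hm : Measurable fun p : E d × E d => gibbsDensity ν ψ p.1 p.2 :=
      A.measurable_gibbsDensity measurable_fst measurable_snd
    have hnn : 0 ≤ᵐ[(μ.map h).prod ν] fun p => gibbsDensity ν ψ p.1 p.2 :=
      ae_of_all _ fun p => gibbsDensity_nonneg _ _
    have hlint : ∫⁻ p, ENNReal.ofReal (gibbsDensity ν ψ p.1 p.2) ∂(μ.map h).prod ν = 1 := by
      rw [lintegral_prod _ hm.ennreal_ofReal.aemeasurable]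
      simp [A.lintegral_gibbsDensity]
    have key := coe_integral_le_klDiv (Q := (μ.map h).prod ν) ig
      ((lintegral_ofReal_ne_top_iff_integrable hm.aestronglyMeasurable hnn).mp (by simp [hlint]))
      ((integral_eq_lintegral_of_nonneg_ae hnn hm.aestronglyMeasurable).trans_le (by simp [hlint]))
    refine (EReal.le_sub_iff_add_le (Or.inl (EReal.coe_ne_bot _))
      (Or.inl (EReal.coe_ne_top _))).mpr (le_trans (le_of_eq ?_) key)
    rw [← EReal.coe_add, EReal.coe_eq_coe_iff, integral_sub i1 il, integral_add hcr iψ,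
      integral_snd_of_mem_Cpl hπ A.integrable, integral_fst_of_mem_Cpl hπ hl',
      integral_map hh.aemeasurable A.measurable_logPartition.aestronglyMeasurable, crossMoment]
    have e : ∫ x, innerObjective ν ψ x (h x) ∂μ =
        ∫ x, inner ℝ (h x) x ∂μ - ∫ x, logPartition ν ψ (h x) ∂μ := integral_sub hC hl
    rw [e]
    ring

lemma solvesVP_and_solvesSP (A : Admissible ν ψ) [IsProbabilityMeasure ν]
    [IsProbabilityMeasure μ] (hμ2 : MemLp (fun x => x) 2 μ) (hν2 : MemLp (fun y => y) 2 ν)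
    {h : E d → E d} (hh : Measurable h) (hh2 : MemLp h 2 μ)
    (hmean : ∀ᵐ x ∂μ, gibbsMean ν ψ (h x) = x) (hsnd : (plan μ ν ψ h).snd = ν)
    (hL : Integrable (fun x => innerObjective ν ψ x (h x)) μ)
    (hπ : plan (μ.map h) ν ψ id ∈ Cpl (μ.map h) ν) :
    SolvesVP μ ν (μ.map h) ∧ SolvesSP (μ.map h) ν (plan (μ.map h) ν ψ id) := by
  obtain ⟨h1, h2⟩ := A.spObjective_bounds hμ2 hν2 hh hh2 hmean hsnd hL
  have hP2 : μ.map h ∈ P2 d := ⟨Measure.isProbabilityMeasure_map hh.aemeasurable,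
    (memLp_map_measure_iff (by fun_prop) hh.aemeasurable).mpr hh2⟩
  refine ⟨⟨hP2, fun η hη => ?_⟩, hπ, fun π hπ' => h1.trans_le (h2 π hπ')⟩
  refine (A.vpObjective_le hν2 hh hmean hsnd hL hη).trans ?_
  -- the law of `(h(X), X)` bounds the maximal covariance from below
  have hp : Measurable fun x : E d => (h x, x) := hh.prodMk measurable_id
  have hκ : μ.map (fun x => (h x, x)) ∈ Cpl (μ.map h) μ := by
    constructor
    · rw [Measure.fst, Measure.map_map measurable_fst hp]; rfl
    · rw [Measure.snd, Measure.map_map measurable_snd hp]; exact Measure.map_id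
  have hcov : ((∫ x, inner ℝ (h x) x ∂μ : ℝ) : EReal) ≤ MCov (μ.map h) μ := by
    refine le_trans (le_of_eq ?_) (le_iSup₂ (f := fun κ _ => (crossMoment κ : EReal)) _ hκ)
    rw [EReal.coe_eq_coe_iff, crossMoment, integral_map hp.aemeasurable
      (measurable_fst.inner measurable_snd).aestronglyMeasurable]
  refine le_trans (le_of_eq ?_) (add_le_add (le_iInf₂ h2) hcov)
  rw [← EReal.coe_add, sub_add_cancel]

/-! ### The Schrödinger system -/

/-- The Schrödinger system says that both marginals of the plan have density one. -/
lemma isSchrodingerPotentials_of_snd_plan (A : Admissible ν ψ) [IsProbabilityMeasure ν]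
    {η : Measure (E d)} [IsProbabilityMeasure η] (hsnd : (plan η ν ψ id).snd = ν) :
    IsSchrodingerPotentials η ν
      (fun x => -Real.log (∫ y, Real.exp (ψ y + inner ℝ x y) ∂ν)) ψ := by
  have hm : Measurable fun p : E d × E d => ENNReal.ofReal (gibbsDensity ν ψ p.1 p.2) :=
    (A.measurable_gibbsDensity measurable_fst measurable_snd).ennreal_ofReal
  have hmy : Measurable fun y => ∫⁻ x, ENNReal.ofReal (gibbsDensity ν ψ x y) ∂η :=
    hm.lintegral_prod_left'
  have hset : ∀ S, MeasurableSet S →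
      ∫⁻ y in S, ∫⁻ x, ENNReal.ofReal (gibbsDensity ν ψ x y) ∂η ∂ν = ∫⁻ _ in S, 1 ∂ν := by
    intro S hS
    have h1 := A.snd_plan_apply (ρ := η) measurable_id hS
    have h2 : (plan η ν ψ id).snd S = ν S := by rw [hsnd]
    have h3 : ∫⁻ x, ∫⁻ y in S, ENNReal.ofReal (gibbsDensity ν ψ x y) ∂ν ∂η =
        ∫⁻ y in S, ∫⁻ x, ENNReal.ofReal (gibbsDensity ν ψ x y) ∂η ∂ν :=
      lintegral_lintegral_swap hm.aemeasurable
    rw [setLIntegral_one, ← h2, h1, ← h3]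
    rfl
  have hdens : ∀ᵐ y ∂ν, ∫⁻ x, ENNReal.ofReal (gibbsDensity ν ψ x y) ∂η = 1 :=
    ae_eq_of_forall_setLIntegral_eq_of_sigmaFinite hmy measurable_const fun S hS _ => hset S hS
  refine ⟨ae_of_all _ fun x => ?_, ?_⟩
  · simp_rw [exp_potentials_eq_gibbsDensity, A.integral_gibbsDensity]
  · filter_upwards [hdens] with y hy
    simp_rw [exp_potentials_eq_gibbsDensity]
    rw [integral_eq_lintegral_of_nonneg_ae (ae_of_all _ fun x => gibbsDensity_nonneg _ _)
      (A.measurable_gibbsDensity (f := fun x => x) measurable_id measurable_const).aestronglyMeasurable]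
    simp [hy]

end Admissible

/-! ### Dependence on the potential through its almost everywhere class -/

lemma logPartition_congr {ψ' : E d → ℝ} (hψ : ψ =ᵐ[ν] ψ') :
    logPartition ν ψ = logPartition ν ψ' := by
  funext k
  exact congrArg Real.log (integral_congr_ae (hψ.mono fun y hy => by simp only [hy]))

lemma innerObjective_congr {ψ' : E d → ℝ} (hψ : ψ =ᵐ[ν] ψ') :
    innerObjective ν ψ = innerObjective ν ψ' := by
  funext x k
  rw [innerObjective, innerObjective, logPartition_congr hψ]

lemma dualObjective_congr {ψ' : E d → ℝ} (hψ : ψ =ᵐ[ν] ψ') :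
    dualObjective μ ν ψ = dualObjective μ ν ψ' := by
  rw [dualObjective, dualObjective, innerObjective_congr hψ, integral_congr_ae hψ]

lemma gibbsPlan_congr {ψ' : E d → ℝ} (hψ : ψ =ᵐ[ν] ψ') {h h' : E d → E d} (hh : h =ᵐ[μ] h') :
    gibbsPlan μ ν ψ h = gibbsPlan μ ν ψ' h' := by
  have hg : gibbs ν ψ = gibbs ν ψ' := by
    funext k
    exact tilted_congr (hψ.mono fun y hy => by simp only [hy])
  rw [gibbsPlan, gibbsPlan, Measure.bind, Measure.bind, hg]
  exact congrArg Measure.join (Measure.map_congr (hh.mono fun x hx => by simp only [hx]))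

lemma potentialPlan_congr [SFinite ν] {η : Measure (E d)} [SFinite η] {φ ψ' : E d → ℝ}
    (hψ : ψ =ᵐ[ν] ψ') : potentialPlan η ν φ ψ = potentialPlan η ν φ ψ' := by
  refine withDensity_congr_ae ?_
  have h1 : ∀ᵐ p ∂η.prod ν, ψ p.2 = ψ' p.2 :=
    (Measure.quasiMeasurePreserving_snd (μ := η) (ν := ν)).ae hψ
  filter_upwards [h1] with p hp
  rw [hp]

lemma IsSchrodingerPotentials.congr {ψ' : E d → ℝ} (hψ : ψ =ᵐ[ν] ψ') {η : Measure (E d)}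
    {φ : E d → ℝ} (H : IsSchrodingerPotentials η ν φ ψ') : IsSchrodingerPotentials η ν φ ψ := by
  refine ⟨H.1.mono fun x hx => ?_, ?_⟩
  · rw [← hx]
    exact integral_congr_ae (hψ.mono fun y hy => by simp only [hy])
  · filter_upwards [H.2, hψ] with y hy hy'
    simpa only [hy'] using hy

/-- A measurable version of a potential of linear growth, with the growth bound at every point. -/
lemma exists_admissible_ae_eq (H1 : ∀ q : ℝ, 0 ≤ q → Integrable (fun y => Real.exp (q * ‖y‖)) ν)
    (hψ : AEMeasurable ψ ν)
    (hgrowth : ∃ a b : ℝ, 0 ≤ a ∧ 0 ≤ b ∧ ∀ᵐ y ∂ν, |ψ y| ≤ a + b * ‖y‖) :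
    ∃ ψ' : E d → ℝ, Admissible ν ψ' ∧ ψ =ᵐ[ν] ψ' := by
  obtain ⟨a, b, ha, hb, hab⟩ := hgrowth
  have hm := hψ.measurable_mk
  refine ⟨fun y => max (-(a + b * ‖y‖)) (min (hψ.mk ψ y) (a + b * ‖y‖)),
    ⟨by fun_prop, ⟨a, b, ha, hb, fun y => ?_⟩, H1⟩, ?_⟩
  · have : 0 ≤ a + b * ‖y‖ := by positivity
    exact abs_le.mpr ⟨le_max_left _ _, max_le (by linarith) (min_le_right _ _)⟩
  · filter_upwards [hab, hψ.ae_eq_mk] with y hy hy'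
    obtain ⟨h1, h2⟩ := abs_le.mp hy
    rw [← hy', min_eq_left h2, max_eq_right h1]

end MSB

/-! ### Conclusion -/

theorem mainTheorem2 (d : ℕ) (μ ν : Measure (MSB.E d))
    (hμ : μ ∈ MSB.P2 d) (hν : ν ∈ MSB.P2 d) (hμν : MSB.ConvexOrder μ ν)
    -- finite exponential moments
    (H1 : ∀ q : ℝ, 0 ≤ q → Integrable (fun y => Real.exp (q * ‖y‖)) ν)
    -- not concentrated on a hyperplane
    (H2 : ∀ u : MSB.E d, u ≠ 0 → ∀ α : ℝ, ¬ ∀ᵐ y ∂ν, inner ℝ u y = α)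
    -- finite dual value, attained by a potential of linear growth
    (ψ : MSB.E d → ℝ) (hψ : Integrable ψ ν)
    (hψ_growth : ∃ a b : ℝ, 0 ≤ a ∧ 0 ≤ b ∧ ∀ᵐ y ∂ν, |ψ y| ≤ a + b * ‖y‖)
    (hD_bot : MSB.dualValue μ ν ≠ ⊥) (hD_top : MSB.dualValue μ ν ≠ ⊤)
    (hD : MSB.dualObjective μ ν ψ = MSB.dualValue μ ν)
    -- the inner problem has the unique solution `h x` for almost every `x`
    (h : MSB.E d → MSB.E d)
    (H4 : ∀ᵐ x ∂μ, MSB.IsUniqueInnerSolution ν ψ x (h x)) :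
    let μbar : Measure (MSB.E d) := μ.map h
    let φbar : MSB.E d → ℝ :=
      fun x => -Real.log (∫ y, Real.exp (ψ y + inner ℝ x y) ∂ν)
    let π : Measure (MSB.E d × MSB.E d) := MSB.potentialPlan μbar ν φbar ψ
    let m : Measure (MSB.E d × MSB.E d) := MSB.gibbsPlan μ ν ψ h
    AEMeasurable h μ ∧
    π ∈ MSB.Cpl μbar ν ∧
    MSB.IsSchrodingerPotentials μbar ν φbar ψ ∧
    (MemLp h 2 μ → MSB.SolvesVP μ ν μbar ∧ MSB.SolvesSP μbar ν π) ∧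
    m ∈ MSB.MT μ ν ∧
    MSB.SolvesP μ ν m := by
  have hμp := hμ.1
  have hνp := hν.1
  obtain ⟨ψ', A, hψψ'⟩ := MSB.exists_admissible_ae_eq H1 hψ.1.aemeasurable hψ_growth
  -- a measurable version of `h`, the inverse of the injective map `MSB.gibbsMean`
  have hemb := A.measurable_gibbsMean.measurableEmbedding (A.gibbsMean_injective H2)
  have hmax : ∀ᵐ x ∂μ, ∀ k, MSB.innerObjective ν ψ' x k ≤ MSB.innerObjective ν ψ' x (h x) := by
    rw [← MSB.innerObjective_congr hψψ']
    exact H4.mono fun x hx => hx.1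
  have hmean : ∀ᵐ x ∂μ, MSB.gibbsMean ν ψ' (h x) = x :=
    hmax.mono fun x hx => A.gibbsMean_eq_of_isMax hx
  obtain ⟨h', hh', hhh'⟩ : ∃ h' : MSB.E d → MSB.E d, Measurable h' ∧ h =ᵐ[μ] h' := by
    refine ⟨hemb.invFun, hemb.measurable_invFun, hmean.mono fun x hx => ?_⟩
    conv_rhs => rw [← hx]
    exact (hemb.leftInverse_invFun (h x)).symm
  have hmax' : ∀ᵐ x ∂μ, ∀ k, MSB.innerObjective ν ψ' x k ≤ MSB.innerObjective ν ψ' x (h' x) := by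
    filter_upwards [hmax, hhh'] with x hx hx'
    rwa [← hx']
  have hmean' : ∀ᵐ x ∂μ, MSB.gibbsMean ν ψ' (h' x) = x := by
    filter_upwards [hmean, hhh'] with x hx hx'
    rwa [← hx']
  rw [MSB.dualObjective_congr hψψ'] at hD
  obtain ⟨hL, hDeq⟩ := A.dualObjective_eq hh' hmax' (by rwa [hD])
  have hsnd := A.snd_plan hh' hL (hD.symm.trans hDeq)
  have hmap : μ.map h = μ.map h' := Measure.map_congr hhh'
  intro μbar φbar π m
  have hφ : φbar = fun x => -Real.log (∫ y, Real.exp (ψ' y + inner ℝ x y) ∂ν) := by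
    funext x
    exact congrArg (fun t => -Real.log t)
      (integral_congr_ae (hψψ'.mono fun y hy => by simp only [hy]))
  have hbar : μbar = μ.map h' := hmap
  have := Measure.isProbabilityMeasure_map (μ := μ) hh'.aemeasurable
  have hm : m = MSB.plan μ ν ψ' h' := (MSB.gibbsPlan_congr hψψ' hhh').trans (A.gibbsPlan_eq_plan hh')
  have hπ : π = MSB.plan (μ.map h') ν ψ' id := by
    rw [← MSB.potentialPlan_eq_plan, ← hφ, ← MSB.potentialPlan_congr hψψ', ← hbar]
  have hπC : MSB.plan (μ.map h') ν ψ' id ∈ MSB.Cpl (μ.map h') ν := by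
    have h1 := MSB.map_prodMap_mem_Cpl (P := MSB.plan μ ν ψ' h') hh'
    rw [A.fst_plan hh', hsnd] at h1
    rwa [← A.map_plan hh' measurable_id]
  have hμ1 : Integrable (fun x => x) μ := hμ.2.integrable one_le_two
  have hν1 : Integrable (fun y => y) ν := hν.2.integrable one_le_two
  have hmMT := A.plan_mem_MT hμ1 hν1 hh' hmean' hsnd
  rw [hπ, hm, hbar, hφ]
  refine ⟨⟨h', hh', hhh'⟩, hπC, (A.isSchrodingerPotentials_of_snd_plan hπC.2).congr hψψ',
    fun h2 => ?_, hmMT, hmMT, fun m' hm' => ?_⟩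
  · exact A.solvesVP_and_solvesSP hμ.2 hν.2 hh' ((memLp_congr_ae hhh').mp h2) hmean' hsnd hL hπC
  · have h3 := A.le_klDiv_of_mem_MT hμ1 hh' hL hm'
    rw [← A.klDiv_plan_eq hh' hmean' hsnd hL] at h3
    exact EReal.coe_ennreal_le_coe_ennreal_iff.mp h3
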